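/- Let $\mathfrak g$ be a finite-dimensional complex simple Lie algebra with a Cartan subalgebra $\mathfrak t$, root system $\Phi$, a set of simple roots $\Pi$ and positive roots $\Phi^+$. For a root $\beta$ let $[\beta:\alpha]$ be the coefficient of $\alpha\in\Pi$ in $\beta$. Let $\alpha_q\in\Pi$ have coefficient $1$ in the highest root. The associated *Hermitian involution* $\sigma$ of $\mathfrak g$ is the identity on $\mathfrak g_0=\mathfrak t\oplus\bigoplus_{[\beta:\alpha_q]=0}\mathfrak g^\beta$ and minus the identity on $\mathfrak g_1=\bigoplus_{[\beta:\alpha_q]\neq0}\mathfrak g^\beta$. For $i=0,1$ let $\Phi_i$ be the set of nonzero weights of $\mathfrak t$ in $\mathfrak g_i$ and $\Phi_i^+=\Phi_i\cap\Phi^+$. Write $\lambda\le_0\mu$ if $\mu-\lambda$ is a (possibly empty) sum of elements of $\Phi_0^+$. The set $\mathcal S=\{\gamma_1,\dots,\gamma_r\}\subset\Phi_1^+$ of Harish-Chandra strongly orthogonal roots is $\bigcup_{i\ge1}\mathcal S_i$, where $\mathcal S_1=\min\Phi_1^+$ and $\mathcal S_i=\min\bigl(\Phi_1^+\setminus\bigcup_{j<i}(\mathcal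 S_j\cup\Psi_{\mathcal S_j})\bigr)$ for $i>1$; here $\min$ denotes the set of $\le_0$-minimal elements and $\Psi_{\mathcal T}=\{\beta\in\Phi_1^+ : \beta-\alpha\in\Phi_0^+\text{ for some }\alpha\in\mathcal T\}$. Put $\mathfrak t^-=\operatorname{span}(\gamma_1^\vee,\dots,\gamma_r^\vee)$. The involution $\sigma$ is of *tube type* if a root $\alpha$ lies in $\Phi_1^+$ exactly when $\alpha|_{\mathfrak t^-}=\tfrac12(\gamma_i+\gamma_j)|_{\mathfrak t^-}$ for some $i,j$, and in $\Phi_0$ exactly when $\alpha|_{\mathfrak t^-}=\tfrac12(\gamma_i-\gamma_j)|_{\mathfrak t^-}$ for some $i,j$. Let $\mathrm{Ort}_{\max}(\Phi_1^+)$ be the set of those subsets of $\Phi_1^+$ with pairwise orthogonal elements that are maximal under inclusion among such subsets. For $\mathcal B\subset\Phi_1^+$ put $\mathcal B^{\ge_0}=\{\alpha\in\Phi_1^+ : \beta\le_0\alpha\text{ for some }\beta\in\mathcal B\}$, and let $\mathfrak a_{\mathcal B}$ be the smallest Lie subalgebra of $\mathfrak g$ that contains $\mathfrak g^\beta$ for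 all $\beta\in\mathcal B$ and is stable under the Borel subalgebra $\mathfrak b_0=\mathfrak t\oplus\bigoplus_{\gamma\in\Phi_0^+}\mathfrak g^\gamma$ of $\mathfrak g_0$. Write $\mathcal A\vdash\mathcal B$ if $\mathfrak a_{\mathcal A}\subset\mathfrak a_{\mathcal B}$. **Proposition.** Suppose that $\sigma$ is a Hermitian involution of tube type. Then there is exactly one $\mathcal A_*\in\mathrm{Ort}_{\max}(\Phi_1^+)$ that is an antichain for $\le_0$. Moreover, for every $\mathcal B\in\mathrm{Ort}_{\max}(\Phi_1^+)$ one has $\mathcal A_*\vdash\mathcal B$, and also $\mathcal A_*\subset\mathcal B^{\ge_0}$. -/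

import Mathlib

open LieAlgebra LieAlgebra.IsKilling Module

noncomputable section

namespace HermitianPair

/-! ### Root combinatorics -/

section Combinatorics

variable {ι R M N : Type*} [CommRing R] [AddCommGroup M] [Module R M] [AddCommGroup N] [Module R N]

/-- `θ` is the highest root: `θ - β` is a sum of simple roots for every root `β`. -/
def IsHighestRoot {P : RootPairing ι R M N} (b : P.Base) (θ : ι) : Prop :=
  ∀ β : ι, P.root θ - P.root β ∈ AddSubmonoid.closure (P.root '' b.support)

/-- `[β : α_q]`: the coefficient of the simple root `α_q` in the expansion of the root `β`. -/
def coeff {P : RootPairing ι R M N} [P.IsRootSystem] (b : P.Base) (q : b.support) (β : ι) : R :=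
  b.toWeightBasis.repr (P.root β) q

variable (P : RootPairing ι R M N)

/-- The dominance order `≤₀` attached to a set `Φ₀p` of positive roots of `Φ₀`, on roots:
`α ≤₀ β` if `β - α` is a sum (possibly empty) of elements of `Φ₀p`. -/
def DomLE (Φ₀p : Set ι) (α β : ι) : Prop :=
  P.root β - P.root α ∈ AddSubmonoid.closure (P.root '' Φ₀p)

/-- `Ort(Φ₁⁺)`: the subsets of `Φ₁p` whose elements are pairwise orthogonal. -/
def Ort (Φ₁p : Set ι) : Set (Set ι) :=
  {B | B ⊆ Φ₁p ∧ B.Pairwise P.IsOrthogonal}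

/-- `Ort_max(Φ₁⁺)`: the orthogonal subsets that are maximal with respect to inclusion. -/
def OrtMax (Φ₁p : Set ι) : Set (Set ι) :=
  {B | Maximal (fun C : Set ι => C ∈ Ort P Φ₁p) B}

/-- `B^{≥₀}`: the elements of `Φ₁p` lying above some element of `B`. -/
def upClosure (Φ₀p Φ₁p B : Set ι) : Set ι :=
  {α | α ∈ Φ₁p ∧ ∃ β ∈ B, DomLE P Φ₀p β α}

/-- The set of minimal elements of `S` for the dominance order. -/
def minElems (Φ₀p S : Set ι) : Set ι :=
  {β | β ∈ S ∧ ∀ α ∈ S, DomLE P Φ₀p α β → α = β}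

/-- `Ψ_S`: the elements of `Φ₁p` of the form `α + γ` with `α ∈ S` and `γ ∈ Φ₀p`. -/
def shadow (Φ₀p Φ₁p S : Set ι) : Set ι :=
  {β | β ∈ Φ₁p ∧ ∃ α ∈ S, ∃ γ ∈ Φ₀p, P.root β - P.root α = P.root γ}

/-- The increasing unions `S₁ ∪ … ∪ Sₙ`, where
`Sₙ₊₁ = min (Φ₁⁺ \ ⋃_{j ≤ n} (Sⱼ ∪ Ψ_{Sⱼ}))`. -/
def harishChandraStep (Φ₀p Φ₁p : Set ι) : ℕ → Set ι
  | 0 => ∅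
  | n + 1 => harishChandraStep Φ₀p Φ₁p n ∪
      minElems P Φ₀p
        (Φ₁p \ (harishChandraStep Φ₀p Φ₁p n ∪ shadow P Φ₀p Φ₁p (harishChandraStep Φ₀p Φ₁p n)))

/-- The set of Harish-Chandra strongly orthogonal roots. -/
def harishChandra (Φ₀p Φ₁p : Set ι) : Set ι :=
  ⋃ n, harishChandraStep P Φ₀p Φ₁p n

/-- `𝔱⁻`: the span of the coroots of the Harish-Chandra strongly orthogonal roots. -/
def tMinus (Φ₀p Φ₁p : Set ι) : Submodule R N :=
  Submodule.span R (P.coroot '' harishChandra P Φ₀p Φ₁p)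

end Combinatorics

/-! ### Hermitian involutions -/

variable {L : Type*} [LieRing L] [LieAlgebra ℂ L] [FiniteDimensional ℂ L] [IsSimple ℂ L]
  {H : LieSubalgebra ℂ L} [H.IsCartanSubalgebra]

/-- `σ` is the Hermitian involution attached to the simple root `α_q`: the coefficient of `α_q` in
the highest root is `1`, and `σ` is the identity on the Levi factor
`𝔩 = H ⊕ ⨁_{[β : α_q] = 0} 𝔤^β` and minus the identity on `𝔭ᵤ⁺ ⊕ 𝔭ᵤ⁻ = ⨁_{[β : α_q] ≠ 0} 𝔤^β`. -/
structure IsHermitianInvolution (b : (rootSystem H).Base) (q : b.support) (σ : L ≃ₗ⁅ℂ⁆ L) :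
    Prop where
  coeff_highest : ∃ θ : H.root, IsHighestRoot b θ ∧ coeff b q θ = 1
  cartan : ∀ h : H, σ h = h
  levi : ∀ β : H.root, coeff b q β = 0 → ∀ x ∈ rootSpace H β, σ x = x
  nilradical : ∀ β : H.root, coeff b q β ≠ 0 → ∀ x ∈ rootSpace H β, σ x = -x

/-- `Φ₀`: the nonzero weights of `H` in `𝔤₀`, the `1`-eigenspace of `σ`. -/
def Phi₀ (H : LieSubalgebra ℂ L) [H.IsCartanSubalgebra] (σ : L ≃ₗ⁅ℂ⁆ L) : Set H.root :=
  {β | ∃ x ∈ rootSpace H β, x ≠ 0 ∧ σ x = x}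

/-- `Φ₁`: the nonzero weights of `H` in `𝔤₁`, the `(-1)`-eigenspace of `σ`. -/
def Phi₁ (H : LieSubalgebra ℂ L) [H.IsCartanSubalgebra] (σ : L ≃ₗ⁅ℂ⁆ L) : Set H.root :=
  {β | ∃ x ∈ rootSpace H β, x ≠ 0 ∧ σ x = -x}

/-- `Φ₀⁺`. -/
def Phi₀Pos (b : (rootSystem H).Base) (σ : L ≃ₗ⁅ℂ⁆ L) : Set H.root :=
  {β | β ∈ Phi₀ H σ ∧ b.IsPos β}

/-- `Φ₁⁺`. -/
def Phi₁Pos (b : (rootSystem H).Base) (σ : L ≃ₗ⁅ℂ⁆ L) : Set H.root :=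
  {β | β ∈ Phi₁ H σ ∧ b.IsPos β}

/-- The Hermitian involution `σ` is of tube type: writing `γ₁, …, γ_r` for the Harish-Chandra
strongly orthogonal roots, a root is in `Φ₁⁺` if and only if its restriction to `𝔱⁻` is
`(γᵢ + γⱼ) / 2` for some `i, j`, and it is in `Φ₀` if and only if its restriction to `𝔱⁻` is
`(γᵢ - γⱼ) / 2` for some `i, j`. -/
structure IsTubeType (b : (rootSystem H).Base) (σ : L ≃ₗ⁅ℂ⁆ L) : Prop where
  mem_Phi₁Pos_iff : ∀ α : H.root, α ∈ Phi₁Pos b σ ↔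
    ∃ γ ∈ harishChandra (rootSystem H) (Phi₀Pos b σ) (Phi₁Pos b σ),
    ∃ γ' ∈ harishChandra (rootSystem H) (Phi₀Pos b σ) (Phi₁Pos b σ),
      ∀ t ∈ tMinus (rootSystem H) (Phi₀Pos b σ) (Phi₁Pos b σ),
        (rootSystem H).root α t =
          (1 / 2 : ℂ) * ((rootSystem H).root γ t + (rootSystem H).root γ' t)
  mem_Phi₀_iff : ∀ α : H.root, α ∈ Phi₀ H σ ↔
    ∃ γ ∈ harishChandra (rootSystem H) (Phi₀Pos b σ) (Phi₁Pos b σ),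
    ∃ γ' ∈ harishChandra (rootSystem H) (Phi₀Pos b σ) (Phi₁Pos b σ),
      ∀ t ∈ tMinus (rootSystem H) (Phi₀Pos b σ) (Phi₁Pos b σ),
        (rootSystem H).root α t =
          (1 / 2 : ℂ) * ((rootSystem H).root γ t - (rootSystem H).root γ' t)

/-- The Borel subalgebra `𝔟₀` of `𝔤₀` corresponding to `Φ₀⁺`, as a subspace of `𝔤`. -/
def borel₀ (b : (rootSystem H).Base) (σ : L ≃ₗ⁅ℂ⁆ L) : Submodule ℂ L :=
  H.toSubmodule ⊔ ⨆ γ ∈ Phi₀Pos b σ, (rootSpace H (γ : H → ℂ)).toSubmodule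

/-- `𝔞_B`: the `B₀`-stable subalgebra generated by `B`, that is, the smallest subalgebra of `𝔤`
that is stable under `𝔟₀` and contains the root spaces of the elements of `B`. -/
def stableSubalgebra (b : (rootSystem H).Base) (σ : L ≃ₗ⁅ℂ⁆ L) (B : Set H.root) :
    LieSubalgebra ℂ L :=
  sInf {S | (∀ β ∈ B, ∀ x ∈ rootSpace H β, x ∈ S) ∧ ∀ y ∈ borel₀ b σ, ∀ x ∈ S, ⁅y, x⁆ ∈ S}

/-- The preorder `B₁ ⊢ B₂`: the inclusion `𝔞_{B₁} ⊆ 𝔞_{B₂}`. -/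
def Turnstile (b : (rootSystem H).Base) (σ : L ≃ₗ⁅ℂ⁆ L) (B₁ B₂ : Set H.root) : Prop :=
  stableSubalgebra b σ B₁ ≤ stableSubalgebra b σ B₂

end HermitianPair

end

set_option linter.unusedSectionVars false

/-! Everything about roots takes place in a grading by degrees -1, 0, 1 (the coefficient of `α_q`),
where `Φ₁⁺` is the degree 1 part. Elements of `Φ₁⁺` pair nonnegatively, since otherwise their sum
would be a root of degree 2, and non-orthogonal ones are comparable.

Existence: suppose that a maximal orthogonal `B` contains `β' < β` with `β'` minimal in `B`. Some
`α` in between is orthogonal to neither (`exists_between`). A reflection in `β - α` or `α - β'`, or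
in one case the replacement of both roots by `α`, gives a maximal orthogonal set inside the upper
closure of `B` whose own upper closure misses `β'` (`exists_ortMax_notMem`). Upper closures shrink,
so the process ends at an antichain in `B^{≥₀}`. Tube type is not needed for this.

Uniqueness: by tube type the Harish-Chandra coroots add up to an element equal to 2 on `Φ₁⁺` and 0
on `Φ₀`. The coroots of every maximal orthogonal `T` have the same sum (`sum_pairingIn_eq`). If `T`
is also an antichain, minus the product of its reflections is an order-reversing involution of `Φ₁⁺`
fixing `T` pointwise. Hence each element of `T` has as many elements above as below. Distinct
elements with this property are incomparable, hence orthogonal, so by maximality they make up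
exactly `T` (`eq_setOf_ncard_eq`), a description free of `T`.

Thus the antichain found in each `B^{≥₀}` is the same one. The relation `⊢` follows because a
`𝔟₀`-stable subspace containing a root space of `Φ₁⁺` contains all those above it, by `sl₂` theory
(`rootSpace_le_of_root_sub`). -/

namespace HermitianPair

/-! ### Pairings and the dominance order in a grading with degrees -1, 0, 1 -/

section AbelianGrading

variable {ι K M N : Type*} [Finite ι] [Field K] [CharZero K] [AddCommGroup M] [Module K M]
  [AddCommGroup N] [Module K N]

/-- `Φ₁p` consists of the roots of degree `1` and `Φ₀p` is a positive system of the roots of degree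
`0`, for a linear functional `d` with values in `{-1, 0, 1}` on roots; the functional `f` witnesses
positivity on `Φ₀p`. -/
structure IsAbelianGrading (P : RootPairing ι K M N) (d f : M →ₗ[K] K) (Φ₀p Φ₁p : Set ι) :
    Prop where
  degree_root : ∀ i, d (P.root i) = -1 ∨ d (P.root i) = 0 ∨ d (P.root i) = 1
  mem_one_iff : ∀ i, i ∈ Φ₁p ↔ d (P.root i) = 1
  degree_zero : ∀ i ∈ Φ₀p, d (P.root i) = 0
  pos_or_neg : ∀ i, d (P.root i) = 0 → i ∈ Φ₀p ∨ ∃ j ∈ Φ₀p, P.root j = -P.root i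
  height_pos : ∀ i ∈ Φ₀p, ∃ n : ℕ, 0 < n ∧ f (P.root i) = n

section Pairing

variable (P : RootPairing ι K M N) [P.IsCrystallographic]

lemma coroot'_root (i j : ι) : P.coroot' j (P.root i) = (P.pairingIn ℤ i j : K) := by
  rw [P.root_coroot'_eq_pairing, ← P.algebraMap_pairingIn ℤ]; simp

variable {P}

lemma pairingIn_sub {i k l : ι} (h : P.root k = P.root i - P.root l) (j : ι) :
    P.pairingIn ℤ k j = P.pairingIn ℤ i j - P.pairingIn ℤ l j := by
  have := congrArg (P.coroot' j) h
  simp only [map_sub, coroot'_root] at this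
  exact_mod_cast this

lemma pairingIn_neg {i k : ι} (h : P.root k = -P.root i) (j : ι) :
    P.pairingIn ℤ k j = -P.pairingIn ℤ i j := by
  have := congrArg (P.coroot' j) h
  simp only [map_neg, coroot'_root] at this
  exact_mod_cast this

lemma pairingIn_add_sub {a b c k : ι} (h : P.root k = P.root a + P.root b - P.root c) (j : ι) :
    P.pairingIn ℤ k j = P.pairingIn ℤ a j + P.pairingIn ℤ b j - P.pairingIn ℤ c j := by
  have := congrArg (P.coroot' j) h
  simp only [map_add, map_sub, coroot'_root] at this
  exact_mod_cast this

lemma pairingIn_sub_zsmul {i k l : ι} {n : ℤ} (h : P.root k = P.root i - n • P.root l) (j : ι) :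
    P.pairingIn ℤ k j = P.pairingIn ℤ i j - n * P.pairingIn ℤ l j := by
  have := congrArg (P.coroot' j) h
  simp only [map_sub, map_zsmul, coroot'_root, zsmul_eq_mul] at this
  exact_mod_cast this

lemma pairingIn_neg_right {i k : ι} (h : P.root k = -P.root i) (j : ι) :
    P.pairingIn ℤ j k = -P.pairingIn ℤ j i := by
  have : k = P.reflectionPerm i i := by
    apply P.root.injective
    simpa [P.root_reflectionPerm] using h
  rw [this, P.pairingIn_reflectionPerm_self_right]

lemma pairingIn_multiset_sum (s : Multiset ι) {i l : ι}
    (h : P.root i - P.root l = (s.map P.root).sum) (j : ι) :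
    P.pairingIn ℤ i j - P.pairingIn ℤ l j = (s.map fun k ↦ P.pairingIn ℤ k j).sum := by
  have := congrArg (P.coroot' j) h
  rw [map_sub, coroot'_root, coroot'_root, map_multiset_sum, Multiset.map_map] at this
  have h2 : (s.map (P.coroot' j ∘ P.root)).sum =
      (((s.map fun k ↦ P.pairingIn ℤ k j).sum : ℤ) : K) := by
    clear h this
    induction s using Multiset.induction_on with
    | empty => simp
    | cons a s ih =>
      rw [Multiset.map_cons, Multiset.sum_cons, ih, Function.comp_apply, coroot'_root,
        Multiset.map_cons, Multiset.sum_cons, Int.cast_add]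
  rw [h2] at this
  exact_mod_cast this

lemma root_reflectionPerm_eq (i j : ι) :
    P.root (P.reflectionPerm i j) = P.root j - P.pairingIn ℤ j i • P.root i := by
  rw [P.root_reflectionPerm, P.reflection_apply_root' ℤ]

lemma exists_root_eq_neg (i : ι) : ∃ k, P.root k = -P.root i :=
  ⟨P.reflectionPerm i i, by simp⟩

lemma pairingIn_pos_comm {i j : ι} : 0 < P.pairingIn ℤ i j ↔ 0 < P.pairingIn ℤ j i :=
  P.zero_lt_pairingIn_iff' ℤ

lemma pairingIn_zero_comm {i j : ι} : P.pairingIn ℤ i j = 0 ↔ P.pairingIn ℤ j i = 0 := by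
  have : Module.IsReflexive K M := .of_isPerfPair P.toLinearMap
  exact P.pairingIn_eq_zero_iff

lemma isOrthogonal_iff_pairingIn {i j : ι} : P.IsOrthogonal i j ↔ P.pairingIn ℤ i j = 0 := by
  have key : ∀ i j, P.pairing i j = 0 ↔ P.pairingIn ℤ i j = 0 := fun i j ↦ by
    rw [← P.algebraMap_pairingIn ℤ]; simp
  rw [RootPairing.IsOrthogonal, key, key, pairingIn_zero_comm (i := j), and_self]

/-- The product of the reflections in pairwise orthogonal roots maps roots to roots. -/
lemma exists_root_eq_sub_sum (S : Finset ι)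
    (hS : (S : Set ι).Pairwise fun a c ↦ P.pairingIn ℤ a c = 0) (i : ι) :
    ∃ k, P.root k = P.root i - ∑ a ∈ S, P.pairingIn ℤ i a • P.root a := by
  classical
  induction S using Finset.induction_on with
  | empty => exact ⟨i, by simp⟩
  | insert c S hc ih =>
    obtain ⟨k, hk⟩ := ih (hS.mono (by simp))
    refine ⟨P.reflectionPerm c k, ?_⟩
    have hp : P.pairingIn ℤ k c = P.pairingIn ℤ i c := by
      have := congrArg (P.coroot' c) hk
      simp only [map_sub, map_sum, map_zsmul, coroot'_root] at this
      rw [Finset.sum_eq_zero, sub_zero] at this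
      · exact_mod_cast this
      · intro a ha
        have : P.pairingIn ℤ a c = 0 :=
          hS (by simp [ha]) (by simp) (by rintro rfl; exact hc ha)
        simp [this]
    rw [root_reflectionPerm_eq, hp, hk, Finset.sum_insert hc]
    abel

end Pairing

section Order

variable {P : RootPairing ι K M N} {Φ₀p : Set ι}

lemma DomLE.refl (α : ι) : DomLE P Φ₀p α α := by simp [DomLE]

lemma DomLE.trans {α β γ : ι} (h : DomLE P Φ₀p α β) (h' : DomLE P Φ₀p β γ) :
    DomLE P Φ₀p α γ := by
  have := add_mem h h'
  rwa [show P.root β - P.root α + (P.root γ - P.root β) = P.root γ - P.root α by abel] at this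

lemma domLE_of_root_sub {α β k : ι} (hk : k ∈ Φ₀p) (h : P.root k = P.root β - P.root α) :
    DomLE P Φ₀p α β := by
  rw [DomLE, ← h]
  exact AddSubmonoid.subset_closure ⟨k, hk, rfl⟩

lemma domLE_iff_exists_multiset {α β : ι} : DomLE P Φ₀p α β ↔
    ∃ s : Multiset ι, (∀ k ∈ s, k ∈ Φ₀p) ∧ P.root β - P.root α = (s.map P.root).sum := by
  constructor
  · intro h
    have h : P.root β - P.root α ∈ AddSubmonoid.closure (P.root '' Φ₀p) := h
    generalize P.root β - P.root α = x at h
    induction h using AddSubmonoid.closure_induction with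
    | mem x hx =>
      obtain ⟨k, hk, rfl⟩ := hx
      exact ⟨{k}, by simpa using hk, by simp⟩
    | zero => exact ⟨0, by simp, by simp⟩
    | add x y _ _ hx hy =>
      obtain ⟨s, hs, rfl⟩ := hx
      obtain ⟨t, ht, rfl⟩ := hy
      refine ⟨s + t, fun k hk ↦ ?_, by simp⟩
      rcases Multiset.mem_add.mp hk with hk | hk
      exacts [hs k hk, ht k hk]
  · rintro ⟨s, hs, h⟩
    rw [DomLE, h]
    refine AddSubmonoid.multiset_sum_mem _ _ fun x hx ↦ ?_
    obtain ⟨k, hk, rfl⟩ := Multiset.mem_map.mp hx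
    exact AddSubmonoid.subset_closure ⟨k, hs k hk, rfl⟩

end Order

namespace IsAbelianGrading

variable {P : RootPairing ι K M N} [P.IsCrystallographic] {d f : M →ₗ[K] K} {Φ₀p Φ₁p : Set ι}
  (hG : IsAbelianGrading P d f Φ₀p Φ₁p)

include hG

/-- Positivity of `f` makes the cone generated by `Φ₀p` pointed, whence antisymmetry of the order.
-/
lemma eq_zero_or_height_pos {x : M} (hx : x ∈ AddSubmonoid.closure (P.root '' Φ₀p)) :
    x = 0 ∨ ∃ n : ℕ, 0 < n ∧ f x = n := by
  induction hx using AddSubmonoid.closure_induction with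
  | mem x hx =>
    obtain ⟨k, hk, rfl⟩ := hx
    exact .inr (hG.height_pos k hk)
  | zero => exact .inl rfl
  | add x y _ _ hx hy =>
    rcases hx with rfl | ⟨n, hn, hx⟩ <;> rcases hy with rfl | ⟨m, hm, hy⟩
    · simp
    · exact .inr ⟨m, hm, by simpa using hy⟩
    · exact .inr ⟨n, hn, by simpa using hx⟩
    · exact .inr ⟨n + m, by positivity, by simp [hx, hy]⟩

lemma eq_zero_of_mem_of_neg_mem {x : M} (hx : x ∈ AddSubmonoid.closure (P.root '' Φ₀p))
    (hx' : -x ∈ AddSubmonoid.closure (P.root '' Φ₀p)) : x = 0 := by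
  rcases hG.eq_zero_or_height_pos hx with h | ⟨n, hn, h⟩
  · exact h
  rcases hG.eq_zero_or_height_pos hx' with h' | ⟨m, hm, h'⟩
  · simpa using h'
  · rw [map_neg, h] at h'
    have : (n : K) + m = 0 := by rw [← h']; ring
    norm_cast at this
    lia

lemma domLE_antisymm {α β : ι} (h : DomLE P Φ₀p α β) (h' : DomLE P Φ₀p β α) : α = β := by
  have := hG.eq_zero_of_mem_of_neg_mem h (by rwa [neg_sub])
  exact P.root.injective (sub_eq_zero.mp this).symm

lemma degree_eq {n : ℤ} {i : ι} (h : d (P.root i) = n) : n = -1 ∨ n = 0 ∨ n = 1 := by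
  have := hG.degree_root i
  rw [h] at this
  exact_mod_cast this

/-- The source of the numerical bounds: a reflected root is again a root, so its degree is at most 1
in absolute value. -/
lemma degree_reflection (i j : ι) {m n : ℤ} (hi : d (P.root i) = m) (hj : d (P.root j) = n) :
    m - P.pairingIn ℤ i j * n = -1 ∨ m - P.pairingIn ℤ i j * n = 0 ∨
      m - P.pairingIn ℤ i j * n = 1 := by
  refine hG.degree_eq (i := P.reflectionPerm j i) ?_
  rw [root_reflectionPerm_eq, map_sub, map_zsmul, hi, hj]
  simp

lemma pairingIn_le_two {i j : ι} (hi : i ∈ Φ₁p) (hj : j ∈ Φ₁p) : P.pairingIn ℤ i j ≤ 2 := by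
  have := hG.degree_reflection i j (m := 1) (n := 1) (by simpa using (hG.mem_one_iff i).mp hi)
    (by simpa using (hG.mem_one_iff j).mp hj)
  lia

lemma pairingIn_nonneg {i j : ι} (hi : i ∈ Φ₁p) (hj : j ∈ Φ₁p) : 0 ≤ P.pairingIn ℤ i j := by
  rw [hG.mem_one_iff] at hi hj
  by_contra! h
  have hne : P.root i ≠ -P.root j := by
    intro h
    have := congrArg d h
    rw [map_neg, hi, hj] at this
    norm_num at this
  obtain ⟨k, hk⟩ := P.root_add_root_mem_of_pairingIn_neg h hne
  have := hG.degree_eq (i := k) (n := 2) (by rw [hk, map_add, hi, hj]; norm_num)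
  lia

lemma abs_pairingIn_le_one {i j : ι} (hi : d (P.root i) = 0) (hj : j ∈ Φ₁p) :
    -1 ≤ P.pairingIn ℤ i j ∧ P.pairingIn ℤ i j ≤ 1 := by
  have := hG.degree_reflection i j (m := 0) (n := 1) (by simpa using hi)
    (by simpa using (hG.mem_one_iff j).mp hj)
  lia

/-- A nonzero pairing is positive here, so the difference is a root; it has degree 0, hence it or
its negative lies in `Φ₀p`. -/
lemma exists_pos_sub {i j : ι} (hi : i ∈ Φ₁p) (hj : j ∈ Φ₁p) (hne : i ≠ j)
    (h : P.pairingIn ℤ i j ≠ 0) :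
    (∃ k ∈ Φ₀p, P.root k = P.root i - P.root j) ∨
      ∃ k ∈ Φ₀p, P.root k = P.root j - P.root i := by
  have h := lt_of_le_of_ne (hG.pairingIn_nonneg hi hj) h.symm
  rw [hG.mem_one_iff] at hi hj
  obtain ⟨k, hk⟩ := P.root_sub_root_mem_of_pairingIn_pos h hne
  rcases hG.pos_or_neg k (by rw [hk, map_sub, hi, hj, sub_self]) with hk' | ⟨j, hj, hjk⟩
  · exact .inl ⟨k, hk', hk⟩
  · exact .inr ⟨j, hj, by rw [hjk, hk, neg_sub]⟩

lemma domLE_or_domLE {i j : ι} (hi : i ∈ Φ₁p) (hj : j ∈ Φ₁p) (h : P.pairingIn ℤ i j ≠ 0) :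
    DomLE P Φ₀p i j ∨ DomLE P Φ₀p j i := by
  rcases eq_or_ne i j with rfl | hne
  · exact .inl (.refl i)
  rcases hG.exists_pos_sub hi hj hne h with ⟨k, hk, h⟩ | ⟨k, hk, h⟩
  · exact .inr (domLE_of_root_sub hk h)
  · exact .inl (domLE_of_root_sub hk h)

lemma domLE_pos {α β k : ι} (h : DomLE P Φ₀p α β) (hk : P.root k = P.root β - P.root α)
    (h0 : d (P.root k) = 0) : k ∈ Φ₀p := by
  rcases hG.pos_or_neg k h0 with hk' | ⟨j, hj, hjk⟩
  · exact hk'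
  · have h1 : DomLE P Φ₀p β α := domLE_of_root_sub hj (by rw [hjk, hk, neg_sub])
    have := hG.domLE_antisymm h h1
    subst this
    rw [sub_self] at hk
    have h2 := hG.height_pos j hj
    rw [hjk, hk] at h2
    obtain ⟨n, hn, h2⟩ := h2
    rw [neg_zero, map_zero] at h2
    norm_cast at h2
    lia

/-- If `α, β ∈ Φ₁p` pair to `2`, the root `2β - α` lies in `Φ₁p`, so that a root of `Φ₁p`
orthogonal to `β` is orthogonal to `α`. -/
lemma pairingIn_eq_zero_of_pairingIn_two {α β γ : ι} (hα : α ∈ Φ₁p) (hβ : β ∈ Φ₁p) (hγ : γ ∈ Φ₁p)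
    (h : P.pairingIn ℤ α β = 2) (h0 : P.pairingIn ℤ β γ = 0) : P.pairingIn ℤ α γ = 0 := by
  obtain ⟨k, hk⟩ := exists_root_eq_neg (P := P) (P.reflectionPerm β α)
  rw [root_reflectionPerm_eq, h, neg_sub] at hk
  have hk1 : k ∈ Φ₁p := by
    rw [hG.mem_one_iff] at hα hβ ⊢
    rw [hk, map_sub, map_zsmul, hα, hβ]
    norm_num
  have hp := congrArg (P.coroot' γ) hk
  simp only [map_sub, map_zsmul, coroot'_root, h0] at hp
  have hp : P.pairingIn ℤ k γ = - P.pairingIn ℤ α γ := by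
    simp only [zsmul_eq_mul, Int.cast_zero, mul_zero, zero_sub] at hp
    exact_mod_cast hp
  have h1 := hG.pairingIn_nonneg hk1 hγ
  have h2 := hG.pairingIn_nonneg hα hγ
  lia

lemma sub_mem_one {i k l : ι} (hi : i ∈ Φ₁p) (hl : d (P.root l) = 0)
    (hk : P.root k = P.root i - P.root l) : k ∈ Φ₁p := by
  rw [hG.mem_one_iff] at hi ⊢
  rw [hk, map_sub, hi, hl, sub_zero]

/-- Orthogonal comparable elements of `Φ₁p` have an element of `Φ₁p` in between that is orthogonal
to neither of them. -/
lemma exists_between (n : ℕ) : ∀ s : Multiset ι, s.card = n → (∀ k ∈ s, k ∈ Φ₀p) →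
    ∀ β' ∈ Φ₁p, ∀ β ∈ Φ₁p, P.pairingIn ℤ β' β = 0 →
    P.root β - P.root β' = (s.map P.root).sum →
    ∃ α ∈ Φ₁p, DomLE P Φ₀p β' α ∧ DomLE P Φ₀p α β ∧ 0 < P.pairingIn ℤ α β ∧
      0 < P.pairingIn ℤ α β' := by
  classical
  induction n with
  | zero =>
    intro s hs _ β' _ β _ h0 hsum
    rw [Multiset.card_eq_zero.mp hs, Multiset.map_zero, Multiset.sum_zero, sub_eq_zero] at hsum
    rw [P.root.injective hsum, P.pairingIn_same] at h0
    lia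
  | succ n ih =>
    intro s hs hsΦ β' hβ' β hβ h0 hsum
    -- `β - β'` pairs to 2 with `β`, so some summand pairs positively with `β` and can be subtracted
    -- from it.
    obtain ⟨ε, hεs, hε⟩ : ∃ ε ∈ s, 0 < P.pairingIn ℤ ε β := by
      by_contra! hcon
      have h1 := pairingIn_multiset_sum s hsum β
      rw [P.pairingIn_same, h0] at h1
      have h2 : (s.map fun k ↦ P.pairingIn ℤ k β).sum ≤ (s.map fun _ ↦ (0 : ℤ)).sum :=
        Multiset.sum_map_le_sum_map _ _ hcon
      simp at h2
      lia
    have hεΦ := hsΦ ε hεs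
    have hεd := hG.degree_zero ε hεΦ
    have hε1 : P.pairingIn ℤ ε β = 1 := by
      have := hG.abs_pairingIn_le_one hεd hβ
      lia
    have hβε : β ≠ ε := by
      rintro rfl
      rw [hG.mem_one_iff, hεd] at hβ
      exact zero_ne_one hβ
    obtain ⟨α, hα⟩ := P.root_sub_root_mem_of_pairingIn_pos (pairingIn_pos_comm.mp hε) hβε
    have hαΦ := hG.sub_mem_one hβ hεd hα
    have hαβ : DomLE P Φ₀p α β := domLE_of_root_sub hεΦ (by rw [hα]; abel)
    have hsα : P.root α - P.root β' = ((s.erase ε).map P.root).sum := by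
      rw [← Multiset.cons_erase hεs, Multiset.map_cons, Multiset.sum_cons] at hsum
      rw [hα, sub_right_comm, hsum]
      abel
    have hsΦ' : ∀ k ∈ s.erase ε, k ∈ Φ₀p := fun k hk ↦ hsΦ k (Multiset.mem_of_mem_erase hk)
    have hβ'α : DomLE P Φ₀p β' α := domLE_iff_exists_multiset.mpr ⟨_, hsΦ', hsα⟩
    have hpα : P.pairingIn ℤ α β = 1 := by
      rw [pairingIn_sub hα, P.pairingIn_same, hε1]; rfl
    rcases (hG.pairingIn_nonneg hαΦ hβ').lt_or_eq with hpos | hzero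
    · exact ⟨α, hαΦ, hβ'α, hαβ, by lia, hpos⟩
    obtain ⟨α₁, hα₁Φ, h1, h2, h3, h4⟩ := ih (s.erase ε)
      (by rw [Multiset.card_erase_of_mem hεs, hs]; rfl) hsΦ' β' hβ' α hαΦ
      (pairingIn_zero_comm.mp hzero.symm) hsα
    rcases (hG.pairingIn_nonneg hα₁Φ hβ).lt_or_eq with hpos | hzero₁
    · exact ⟨α₁, hα₁Φ, h1, h2.trans hαβ, hpos, h4⟩
    -- The inductive `α₁` lies between `β'` and `α` but is orthogonal to `β`. Its mirror image `α₂ =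
    -- α + β' - α₁` in that interval inherits the pairing 1 of `α` with `β`.
    have hne : α₁ ≠ β' := by
      rintro rfl
      have := pairingIn_zero_comm.mp hzero.symm
      lia
    obtain ⟨q, hq⟩ := P.root_sub_root_mem_of_pairingIn_pos h4 hne
    have hqd : d (P.root q) = 0 := by
      rw [hq, map_sub, (hG.mem_one_iff _).mp hα₁Φ, (hG.mem_one_iff _).mp hβ', sub_self]
    have hαq : 0 < P.pairingIn ℤ α q := by
      rw [pairingIn_pos_comm, pairingIn_sub hq,
        pairingIn_zero_comm.mp hzero.symm, sub_zero]
      exact h3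
    have hne' : α ≠ q := by
      rintro rfl
      rw [(hG.mem_one_iff _).mp hαΦ] at hqd
      exact one_ne_zero hqd
    obtain ⟨α₂, hα₂⟩ := P.root_sub_root_mem_of_pairingIn_pos hαq hne'
    have hα₂Φ := hG.sub_mem_one hαΦ hqd hα₂
    have hα₂' : P.root α₂ = P.root α + P.root β' - P.root α₁ := by rw [hα₂, hq]; abel
    have h5 : P.pairingIn ℤ α₁ β' ≠ 2 := by
      intro h5
      have := hG.pairingIn_eq_zero_of_pairingIn_two hα₁Φ hβ' hαΦ h5
        (pairingIn_zero_comm.mp hzero.symm)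
      lia
    have h6 := hG.pairingIn_le_two hα₁Φ hβ'
    have h7 : P.root α₂ - P.root β' = P.root α - P.root α₁ := by rw [hα₂']; abel
    have h8 : P.root α - P.root α₂ = P.root α₁ - P.root β' := by rw [hα₂']; abel
    refine ⟨α₂, hα₂Φ, ?_, DomLE.trans (?_ : DomLE P Φ₀p α₂ α) hαβ, ?_, ?_⟩
    · rw [DomLE, h7]; exact h2
    · rw [DomLE, h8]; exact h1
    · rw [pairingIn_add_sub hα₂']; lia
    · rw [pairingIn_add_sub hα₂', P.pairingIn_same]; lia

end IsAbelianGrading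

end AbelianGrading

/-! ### Maximal orthogonal sets and the descent to an antichain -/

section OrtMax

variable {ι K M N : Type*} [Finite ι] [Field K] [CharZero K] [AddCommGroup M] [Module K M]
  [AddCommGroup N] [Module K N] {P : RootPairing ι K M N} [P.IsCrystallographic]

lemma mem_ort_iff {Φ₁p B : Set ι} : B ∈ Ort P Φ₁p ↔
    B ⊆ Φ₁p ∧ B.Pairwise fun a c ↦ P.pairingIn ℤ a c = 0 := by
  have : P.IsOrthogonal = fun a c ↦ P.pairingIn ℤ a c = 0 := by
    ext a c; exact isOrthogonal_iff_pairingIn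
  simp [Ort, this]

lemma mem_ortMax_iff {Φ₁p B : Set ι} : B ∈ OrtMax P Φ₁p ↔
    B ⊆ Φ₁p ∧ (B.Pairwise fun a c ↦ P.pairingIn ℤ a c = 0) ∧
      ∀ γ ∈ Φ₁p, ∃ c ∈ B, P.pairingIn ℤ γ c ≠ 0 := by
  constructor
  · rintro ⟨hB, hmax⟩
    have hB' := mem_ort_iff.mp hB
    refine ⟨hB'.1, hB'.2, fun γ hγ ↦ ?_⟩
    by_contra! hcon
    have hle : insert γ B ∈ Ort P Φ₁p := by
      refine mem_ort_iff.mpr ⟨Set.insert_subset hγ hB'.1, ?_⟩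
      exact hB'.2.insert fun c hc _ ↦ ⟨hcon c hc, pairingIn_zero_comm.mp (hcon c hc)⟩
    have := hcon γ (hmax hle (Set.subset_insert γ B) (Set.mem_insert γ B))
    rw [P.pairingIn_same] at this
    lia
  · rintro ⟨h1, h2, h3⟩
    refine ⟨mem_ort_iff.mpr ⟨h1, h2⟩, fun C hC hBC γ hγ ↦ ?_⟩
    have hC' := mem_ort_iff.mp hC
    obtain ⟨c, hc, hne⟩ := h3 γ (hC'.1 hγ)
    rcases eq_or_ne γ c with rfl | hγc
    · exact hc
    · exact absurd (hC'.2 hγ (hBC hc) hγc) hne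

variable (P) in
lemma exists_mem_ortMax (Φ₁p : Set ι) : ∃ B, B ∈ OrtMax P Φ₁p := by
  have hfin : {B : Set ι | B ∈ Ort P Φ₁p}.Finite := Set.toFinite _
  obtain ⟨B, -, hB⟩ := hfin.exists_le_maximal (a := ∅) (by simp [Ort])
  exact ⟨B, hB⟩

lemma pairingIn_reflectionPerm_reflectionPerm (δ a c : ι) :
    P.pairingIn ℤ (P.reflectionPerm δ a) (P.reflectionPerm δ c) = P.pairingIn ℤ a c := by
  rw [P.pairingIn_reflectionPerm]
  simp

lemma reflectionPerm_eq_self {δ c : ι} (h : P.pairingIn ℤ c δ = 0) :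
    P.reflectionPerm δ c = c := by
  apply P.root.injective
  rw [root_reflectionPerm_eq, h, zero_smul, sub_zero]

lemma domLE_of_root_eq_add_nsmul {Φ₀p : Set ι} {α β k : ι} (hk : k ∈ Φ₀p) (n : ℕ)
    (h : P.root β = P.root α + n • P.root k) : DomLE P Φ₀p α β := by
  rw [DomLE, h, add_sub_cancel_left]
  exact nsmul_mem (AddSubmonoid.subset_closure (Set.mem_image_of_mem _ hk)) n

namespace IsAbelianGrading

variable {d f : M →ₗ[K] K} {Φ₀p Φ₁p : Set ι} (hG : IsAbelianGrading P d f Φ₀p Φ₁p)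

include hG

lemma reflectionPerm_mem_one {δ c : ι} (hδ : d (P.root δ) = 0) (hc : c ∈ Φ₁p) :
    P.reflectionPerm δ c ∈ Φ₁p := by
  rw [hG.mem_one_iff] at hc ⊢
  rw [root_reflectionPerm_eq, map_sub, map_zsmul, hδ, smul_zero, sub_zero, hc]

lemma image_reflectionPerm_mem_ortMax {δ : ι} (hδ : d (P.root δ) = 0) {B : Set ι}
    (hB : B ∈ OrtMax P Φ₁p) : P.reflectionPerm δ '' B ∈ OrtMax P Φ₁p := by
  rw [mem_ortMax_iff] at hB ⊢
  obtain ⟨h1, h2, h3⟩ := hB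
  refine ⟨?_, ?_, fun γ hγ ↦ ?_⟩
  · rintro - ⟨c, hc, rfl⟩
    exact hG.reflectionPerm_mem_one hδ (h1 hc)
  · rintro - ⟨a, ha, rfl⟩ - ⟨c, hc, rfl⟩ hne
    rw [pairingIn_reflectionPerm_reflectionPerm]
    exact h2 ha hc fun h ↦ hne (by rw [h])
  · obtain ⟨c, hc, hne⟩ := h3 _ (hG.reflectionPerm_mem_one hδ hγ)
    exact ⟨_, ⟨c, hc, rfl⟩, by rwa [P.pairingIn_reflectionPerm]⟩

/-- A root of degree zero pairs nontrivially with at most one element of each sign of an orthogonal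
set. -/
lemma pairingIn_ne_of_eq {δ a c : ι} (hδ : d (P.root δ) = 0) (ha : a ∈ Φ₁p) (hc : c ∈ Φ₁p)
    (hac : a ≠ c) (h0 : P.pairingIn ℤ a c = 0) (hne : P.pairingIn ℤ δ a ≠ 0) :
    P.pairingIn ℤ δ c ≠ P.pairingIn ℤ δ a := by
  classical
  intro h
  obtain ⟨k, hk⟩ := exists_root_eq_sub_sum (P := P) {a, c} (by
    rw [Finset.coe_pair, Set.pairwise_pair]
    exact fun _ ↦ ⟨h0, pairingIn_zero_comm.mp h0⟩) δ
  rw [Finset.sum_pair hac, h] at hk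
  -- With equal pairings, reflecting `δ` in both roots gives degree `-2 * P.pairingIn ℤ δ a`, even
  -- and nonzero.
  have := hG.degree_eq (i := k) (n := -2 * P.pairingIn ℤ δ a) (by
    rw [hk, map_sub, map_add, map_zsmul, map_zsmul, hδ, (hG.mem_one_iff a).mp ha,
      (hG.mem_one_iff c).mp hc]
    simp
    ring)
  lia

/-- The reflection in `δ` moves only `β` and `β'` within `B`, and both images lie strictly above
`β'`. The reflected set is the one wanted. -/
lemma exists_ortMax_of_reflection {B : Set ι} (hB : B ∈ OrtMax P Φ₁p) {β' β δ : ι}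
    (hβ' : β' ∈ B) (hβ : β ∈ B) (hmin : ∀ c ∈ B, DomLE P Φ₀p c β' → c = β') (hδ : δ ∈ Φ₀p)
    (hδβ : P.pairingIn ℤ δ β = 1) (hδβ' : P.pairingIn ℤ δ β' = -1)
    (hle : DomLE P Φ₀p β' (P.reflectionPerm δ β)) (hne : P.reflectionPerm δ β ≠ β') :
    ∃ B' ∈ OrtMax P Φ₁p, B' ⊆ upClosure P Φ₀p Φ₁p B ∧ β' ∉ upClosure P Φ₀p Φ₁p B' := by
  have hd := hG.degree_zero δ hδ
  have hB' := mem_ortMax_iff.mp hB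
  obtain ⟨h1, h2, h3⟩ := hB'
  -- The only possible nonzero pairings, 1 and -1, are already taken by `β` and `β'`.
  have hfix : ∀ c ∈ B, c ≠ β → c ≠ β' → P.reflectionPerm δ c = c := by
    intro c hc hcβ hcβ'
    apply reflectionPerm_eq_self
    rw [pairingIn_zero_comm]
    have a1 := hG.pairingIn_ne_of_eq hd (h1 hβ) (h1 hc) hcβ.symm (h2 hβ hc hcβ.symm) (by lia)
    have a2 := hG.pairingIn_ne_of_eq hd (h1 hβ') (h1 hc) hcβ'.symm (h2 hβ' hc hcβ'.symm) (by lia)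
    have a3 := hG.abs_pairingIn_le_one hd (h1 hc)
    lia
  have hneg : P.pairingIn ℤ β' δ < 0 := by
    rw [P.pairingIn_lt_zero_iff]; lia
  obtain ⟨n, hn⟩ := Int.eq_ofNat_of_zero_le (show 0 ≤ -P.pairingIn ℤ β' δ by lia)
  have hβ'root : P.root (P.reflectionPerm δ β') = P.root β' + n • P.root δ := by
    rw [root_reflectionPerm_eq, show P.pairingIn ℤ β' δ = -(n : ℤ) by lia]
    simp
  have hle' : DomLE P Φ₀p β' (P.reflectionPerm δ β') := domLE_of_root_eq_add_nsmul hδ n hβ'root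
  have hne' : P.reflectionPerm δ β' ≠ β' := by
    intro h
    rw [h, left_eq_add, ← natCast_zsmul, ← Int.cast_smul_eq_zsmul K, smul_eq_zero] at hβ'root
    rcases hβ'root with h | h
    · norm_cast at h; lia
    · exact P.ne_zero δ h
  refine ⟨_, hG.image_reflectionPerm_mem_ortMax hd hB, ?_, ?_⟩
  · rintro - ⟨c, hc, rfl⟩
    refine ⟨hG.reflectionPerm_mem_one hd (h1 hc), ?_⟩
    by_cases hcβ : c = β
    · exact ⟨β', hβ', hcβ ▸ hle⟩
    by_cases hcβ' : c = β'
    · exact ⟨β', hβ', hcβ' ▸ hle'⟩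
    · exact ⟨c, hc, by rw [hfix c hc hcβ hcβ']; exact .refl c⟩
  · rintro ⟨-, -, ⟨c, hc, rfl⟩, hcle⟩
    by_cases hcβ : c = β
    · subst hcβ
      exact hne (hG.domLE_antisymm hcle hle)
    by_cases hcβ' : c = β'
    · subst hcβ'
      exact hne' (hG.domLE_antisymm hcle hle')
    · rw [hfix c hc hcβ hcβ'] at hcle
      exact hcβ' (hmin c hc hcle)

/-- Here `α` is the midpoint of `β` and `β'` and replaces both. Maximality survives because pairings
in `Φ₁p` are nonnegative: a root orthogonal to the midpoint is orthogonal to both ends. -/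
lemma exists_ortMax_of_two_smul {B : Set ι} (hB : B ∈ OrtMax P Φ₁p) {β' β α : ι}
    (hβ' : β' ∈ B) (hβ : β ∈ B) (hmin : ∀ c ∈ B, DomLE P Φ₀p c β' → c = β')
    (hα : α ∈ Φ₁p) (hle : DomLE P Φ₀p β' α) (hne : α ≠ β')
    (h : (2 : ℤ) • P.root α = P.root β + P.root β') :
    ∃ B' ∈ OrtMax P Φ₁p, B' ⊆ upClosure P Φ₀p Φ₁p B ∧ β' ∉ upClosure P Φ₀p Φ₁p B' := by
  have hB' := mem_ortMax_iff.mp hB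
  obtain ⟨h1, h2, h3⟩ := hB'
  have hp (j : ι) : 2 * P.pairingIn ℤ α j = P.pairingIn ℤ β j + P.pairingIn ℤ β' j := by
    have := congrArg (P.coroot' j) h
    simp only [map_add, map_zsmul, coroot'_root, zsmul_eq_mul] at this
    exact_mod_cast this
  refine ⟨insert α (B \ {β, β'}), mem_ortMax_iff.mpr ⟨?_, ?_, fun γ hγ ↦ ?_⟩, ?_, ?_⟩
  · exact Set.insert_subset hα (Set.sdiff_subset.trans h1)
  · refine (h2.mono Set.sdiff_subset).insert fun c hc _ ↦ ?_
    obtain ⟨hc, hc'⟩ := hc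
    simp only [Set.mem_insert_iff, Set.mem_singleton_iff, not_or] at hc'
    have h5 := hp c
    rw [h2 hβ hc (Ne.symm hc'.1), h2 hβ' hc (Ne.symm hc'.2)] at h5
    have h6 : P.pairingIn ℤ α c = 0 := by lia
    exact ⟨h6, pairingIn_zero_comm.mp h6⟩
  · obtain ⟨c, hc, hγc⟩ := h3 γ hγ
    by_cases hc' : c ∈ ({β, β'} : Set ι)
    · refine ⟨α, Set.mem_insert _ _, fun h0 ↦ hγc ?_⟩
      rw [pairingIn_zero_comm] at h0 ⊢
      have h5 := hp γ
      have h6 := hG.pairingIn_nonneg (h1 hβ) hγ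
      have h7 := hG.pairingIn_nonneg (h1 hβ') hγ
      rcases hc' with rfl | rfl <;> lia
    · exact ⟨c, Set.mem_insert_of_mem _ ⟨hc, hc'⟩, hγc⟩
  · rintro c (rfl | ⟨hc, -⟩)
    · exact ⟨hα, β', hβ', hle⟩
    · exact ⟨h1 hc, c, hc, .refl c⟩
  · rintro ⟨-, c, rfl | ⟨hc, hc'⟩, hcle⟩
    · exact hne (hG.domLE_antisymm hcle hle)
    · exact hc' (by simp [hmin c hc hcle])

/-- If a maximal orthogonal set contains `β' < β` with `β'` minimal, then there is a maximal
orthogonal set in its upper closure whose upper closure does not contain `β'`. -/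
lemma exists_ortMax_notMem {B : Set ι} (hB : B ∈ OrtMax P Φ₁p) {β' β : ι}
    (hβ' : β' ∈ B) (hβ : β ∈ B) (hmin : ∀ c ∈ B, DomLE P Φ₀p c β' → c = β')
    (hne : β' ≠ β) (hle : DomLE P Φ₀p β' β) :
    ∃ B' ∈ OrtMax P Φ₁p, B' ⊆ upClosure P Φ₀p Φ₁p B ∧ β' ∉ upClosure P Φ₀p Φ₁p B' := by
  obtain ⟨h1, h2, h3⟩ := mem_ortMax_iff.mp hB
  have h0 := h2 hβ' hβ hne
  have h0' := pairingIn_zero_comm.mp h0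
  obtain ⟨s, hs, hsum⟩ := domLE_iff_exists_multiset.mp hle
  obtain ⟨α, hα, l1, l2, p1, p2⟩ :=
    hG.exists_between _ s rfl hs β' (h1 hβ') β (h1 hβ) h0 hsum
  -- The value 2 would force `α` to be orthogonal to `β'`, because `β` is.
  have hαβ : P.pairingIn ℤ α β = 1 := by
    have a1 := hG.pairingIn_le_two hα (h1 hβ)
    have a2 : P.pairingIn ℤ α β ≠ 2 := fun h ↦ by
      have := hG.pairingIn_eq_zero_of_pairingIn_two hα (h1 hβ) (h1 hβ') h h0'
      lia
    lia
  have hαβ' : P.pairingIn ℤ α β' = 1 := by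
    have a1 := hG.pairingIn_le_two hα (h1 hβ')
    have a2 : P.pairingIn ℤ α β' ≠ 2 := fun h ↦ by
      have := hG.pairingIn_eq_zero_of_pairingIn_two hα (h1 hβ') (h1 hβ) h h0
      lia
    lia
  have neβ : α ≠ β := by rintro rfl; rw [P.pairingIn_same] at hαβ; lia
  have neβ' : α ≠ β' := by rintro rfl; rw [P.pairingIn_same] at hαβ'; lia
  have dβ := (hG.mem_one_iff β).mp (h1 hβ)
  have dβ' := (hG.mem_one_iff β').mp (h1 hβ')
  have dα := (hG.mem_one_iff α).mp hα
  obtain ⟨δ, hδ⟩ := P.root_sub_root_mem_of_pairingIn_pos (pairingIn_pos_comm.mp p1) neβ.symm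
  obtain ⟨δ', hδ'⟩ := P.root_sub_root_mem_of_pairingIn_pos p2 neβ'
  have hδΦ : δ ∈ Φ₀p := hG.domLE_pos l2 hδ (by rw [hδ, map_sub, dβ, dα, sub_self])
  have hδΦ' : δ' ∈ Φ₀p := hG.domLE_pos l1 hδ' (by rw [hδ', map_sub, dβ', dα, sub_self])
  have hδβ : P.pairingIn ℤ δ β = 1 := by rw [pairingIn_sub hδ, P.pairingIn_same, hαβ]; rfl
  have hδβ' : P.pairingIn ℤ δ β' = -1 := by rw [pairingIn_sub hδ, h0', hαβ']; rfl
  have hδ'β : P.pairingIn ℤ δ' β = 1 := by rw [pairingIn_sub hδ', h0, hαβ]; rfl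
  have hδ'β' : P.pairingIn ℤ δ' β' = -1 := by rw [pairingIn_sub hδ', P.pairingIn_same, hαβ']; rfl
  have hk : P.root (P.reflectionPerm β α) = -P.root δ := by
    rw [root_reflectionPerm_eq, hαβ, hδ]; simp
  have hβδ : P.pairingIn ℤ β δ = P.pairingIn ℤ β α := by
    have := pairingIn_neg_right hk β
    rw [P.pairingIn_reflectionPerm, P.pairingIn_reflectionPerm_self_left] at this
    lia
  have hβ'δ : P.pairingIn ℤ β' δ = -P.pairingIn ℤ β' α := by
    have := pairingIn_neg_right hk β'
    rw [P.pairingIn_reflectionPerm, reflectionPerm_eq_self h0] at this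
    lia
  have m1 : 0 < P.pairingIn ℤ β α := pairingIn_pos_comm.mp p1
  have m1' : 0 < P.pairingIn ℤ β' α := pairingIn_pos_comm.mp p2
  have m2 := hG.pairingIn_le_two (h1 hβ) hα
  have m2' := hG.pairingIn_le_two (h1 hβ') hα
  have hη := root_reflectionPerm_eq (P := P) δ β
  -- The image of `β` under the reflection in `δ = β - α` is `α` if this pairing is 1, and `2α - β`
  -- if it is 2.
  by_cases hm : P.pairingIn ℤ β α = 1
  · have hη' : P.reflectionPerm δ β = α := by
      apply P.root.injective
      rw [hη, hβδ, hm, hδ]; simp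
    exact hG.exists_ortMax_of_reflection hB hβ' hβ hmin hδΦ hδβ hδβ' (hη' ▸ l1) (hη' ▸ neβ')
  replace hm : P.pairingIn ℤ β α = 2 := by lia
  rw [hβδ, hm, hδ] at hη
  -- If both pairings are 2, that reflection sends `β` to `β'` and gains nothing, but then `2α = β +
  -- β'`.
  by_cases hm' : P.pairingIn ℤ β' α = 2
  · have hηβ' : P.reflectionPerm δ β = β' := by
      rw [← P.pairingIn_two_two_iff ℤ, P.pairingIn_reflectionPerm,
        ← P.pairingIn_reflectionPerm, P.pairingIn_reflectionPerm,
        pairingIn_sub_zsmul (root_reflectionPerm_eq δ β),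
        pairingIn_sub_zsmul (root_reflectionPerm_eq δ β'), h0, h0', hδβ, hδβ', hβδ, hβ'δ, hm, hm']
      norm_num
    refine hG.exists_ortMax_of_two_smul hB hβ' hβ hmin hα l1 neβ' ?_
    rw [hηβ'] at hη
    rw [hη, smul_sub, two_smul, two_smul]
    abel
  replace hm' : P.pairingIn ℤ β' α = 1 := by lia
  have hβδ' : β ≠ δ' := by
    rintro rfl
    rw [hG.degree_zero _ hδΦ'] at dβ
    exact zero_ne_one dβ
  obtain ⟨α', hα'⟩ := P.root_sub_root_mem_of_pairingIn_pos
    (pairingIn_pos_comm.mp (show 0 < P.pairingIn ℤ δ' β by lia)) hβδ'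
  have hα'Φ := hG.sub_mem_one (h1 hβ) (hG.degree_zero _ hδΦ') hα'
  have hα'2 : P.root α' = P.root β + P.root β' - P.root α := by rw [hα', hδ']; abel
  have hα'α : P.pairingIn ℤ α' α = 1 := by
    rw [pairingIn_add_sub hα'2, hm, hm', P.pairingIn_same]; rfl
  have neα : α ≠ α' := by rintro rfl; rw [P.pairingIn_same] at hα'α; lia
  -- With `α' = β + β' - α`, the reflections in `δ` and `δ'` send `β` to `β' + (α - α')` and `β' +
  -- (α' - α)`. The roots `α` and `α'` are comparable, so one of the two images lies above `β'`.
  rcases hG.exists_pos_sub hα hα'Φ neα (by rw [ne_eq, pairingIn_zero_comm]; lia) with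
    ⟨k, hkΦ, hk⟩ | ⟨k, hkΦ, hk⟩
  · have hk' : P.root k = P.root (P.reflectionPerm δ β) - P.root β' := by
      rw [hk, hη, hα'2, smul_sub, two_smul, two_smul]; abel
    refine hG.exists_ortMax_of_reflection hB hβ' hβ hmin hδΦ hδβ hδβ'
      (domLE_of_root_sub hkΦ hk') fun h ↦ P.ne_zero k ?_
    rw [hk', h, sub_self]
  · have hβα' : P.pairingIn ℤ β δ' = 2 := by
      have e1 : P.root (P.reflectionPerm β α') = -P.root δ' := by
        rw [root_reflectionPerm_eq, pairingIn_add_sub hα'2, P.pairingIn_same, h0, hαβ, hα']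
        simp
      have e2 : P.reflectionPerm β' δ = α' := by
        apply P.root.injective
        rw [root_reflectionPerm_eq, hδβ', hα'2, hδ]
        simp
        abel
      have e3 := pairingIn_neg_right e1 β
      rw [P.pairingIn_reflectionPerm, P.pairingIn_reflectionPerm_self_left, ← e2,
        P.pairingIn_reflectionPerm, reflectionPerm_eq_self h0', hβδ, hm] at e3
      lia
    have hη' := root_reflectionPerm_eq (P := P) δ' β
    rw [hβα', hδ'] at hη'
    have hk' : P.root k = P.root (P.reflectionPerm δ' β) - P.root β' := by
      rw [hk, hη', hα'2, smul_sub, two_smul, two_smul]; abel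
    refine hG.exists_ortMax_of_reflection hB hβ' hβ hmin hδΦ' hδ'β hδ'β'
      (domLE_of_root_sub hkΦ hk') fun h ↦ P.ne_zero k ?_
    rw [hk', h, sub_self]

lemma ncard_below_lt {α β : ι} (hβ : β ∈ Φ₁p) (h : DomLE P Φ₀p α β) (hne : α ≠ β) :
    {x ∈ Φ₁p | DomLE P Φ₀p x α}.ncard < {x ∈ Φ₁p | DomLE P Φ₀p x β}.ncard := by
  refine Set.ncard_lt_ncard ⟨fun x hx ↦ ⟨hx.1, hx.2.trans h⟩, fun hsub ↦ hne ?_⟩ (Set.toFinite _)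
  exact hG.domLE_antisymm h (hsub ⟨hβ, .refl β⟩).2

lemma ncard_above_lt {α β : ι} (hα : α ∈ Φ₁p) (h : DomLE P Φ₀p α β) (hne : α ≠ β) :
    {x ∈ Φ₁p | DomLE P Φ₀p β x}.ncard < {x ∈ Φ₁p | DomLE P Φ₀p α x}.ncard := by
  refine Set.ncard_lt_ncard ⟨fun x hx ↦ ⟨hx.1, h.trans hx.2⟩, fun hsub ↦ hne ?_⟩ (Set.toFinite _)
  exact hG.domLE_antisymm h (hsub ⟨hα, .refl α⟩).2

/-- Every upper closure of a maximal orthogonal set contains a maximal orthogonal antichain. -/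
theorem exists_antichain_subset_upClosure (n : ℕ) : ∀ B ∈ OrtMax P Φ₁p,
    (upClosure P Φ₀p Φ₁p B).ncard = n →
    ∃ A ∈ OrtMax P Φ₁p, IsAntichain (DomLE P Φ₀p) A ∧ A ⊆ upClosure P Φ₀p Φ₁p B := by
  induction n using Nat.strong_induction_on with
  | _ n ih =>
  intro B hB hn
  have hB1 : B ⊆ Φ₁p := (mem_ortMax_iff.mp hB).1
  by_cases hanti : IsAntichain (DomLE P Φ₀p) B
  · exact ⟨B, hB, hanti, fun c hc ↦ ⟨hB1 hc, c, hc, .refl c⟩⟩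
  obtain ⟨a, ha, β, hβ, hne, hle⟩ : ∃ a ∈ B, ∃ β ∈ B, a ≠ β ∧ DomLE P Φ₀p a β := by
    simpa [IsAntichain, Set.Pairwise] using hanti
  -- Fewest elements below serves as a choice of a minimal element of `B` under `a`.
  obtain ⟨β', ⟨hβ', hβ'a⟩, hmin⟩ := Set.exists_min_image {c ∈ B | DomLE P Φ₀p c a}
    (fun c ↦ {x ∈ Φ₁p | DomLE P Φ₀p x c}.ncard) (Set.toFinite _) ⟨a, ha, .refl a⟩
  have hmin' : ∀ c ∈ B, DomLE P Φ₀p c β' → c = β' := by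
    intro c hc hcβ'
    by_contra hcon
    exact absurd (hG.ncard_below_lt (hB1 hβ') hcβ' hcon)
      (hmin c ⟨hc, hcβ'.trans hβ'a⟩).not_gt
  have hne' : β' ≠ β := by
    rintro rfl
    exact hne (hG.domLE_antisymm hle hβ'a)
  obtain ⟨B', hB', hsub, hnot⟩ :=
    hG.exists_ortMax_notMem hB hβ' hβ hmin' hne' (hβ'a.trans hle)
  have hup : upClosure P Φ₀p Φ₁p B' ⊆ upClosure P Φ₀p Φ₁p B := by
    rintro x ⟨hx, c, hc, hcx⟩
    obtain ⟨-, b, hb, hbc⟩ := hsub hc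
    exact ⟨hx, b, hb, hbc.trans hcx⟩
  have hlt : (upClosure P Φ₀p Φ₁p B').ncard < n := by
    rw [← hn]
    exact Set.ncard_lt_ncard
      ⟨hup, fun h ↦ hnot (h ⟨hB1 hβ', β', hβ', .refl β'⟩)⟩ (Set.toFinite _)
  obtain ⟨A, hA, hA', hA''⟩ := ih _ hlt B' hB' rfl
  exact ⟨A, hA, hA', hA''.trans hup⟩

end IsAbelianGrading

end OrtMax

/-! ### Sums of coroots and uniqueness of the antichain -/

section Tube

variable {ι K M N : Type*} [Finite ι] [Field K] [CharZero K] [AddCommGroup M] [Module K M]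
  [AddCommGroup N] [Module K N] {P : RootPairing ι K M N} [P.IsCrystallographic]

lemma root'_coroot (i j : ι) : P.root' i (P.coroot j) = (P.pairingIn ℤ i j : K) := by
  rw [P.root'_coroot_eq_pairing, ← P.algebraMap_pairingIn ℤ]; simp

lemma root'_multiset_sum (s : Multiset ι) (i : ι) :
    P.root' i (s.map P.coroot).sum = ((s.map fun k ↦ P.pairingIn ℤ i k).sum : ℤ) := by
  induction s using Multiset.induction_on with
  | empty => simp
  | cons a s ih =>
    rw [Multiset.map_cons, Multiset.sum_cons, map_add, ih, root'_coroot,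
      Multiset.map_cons, Multiset.sum_cons, Int.cast_add]

lemma sum_pairingIn_congr {s t : Multiset ι} (h : (s.map P.coroot).sum = (t.map P.coroot).sum)
    (i : ι) : (s.map fun k ↦ P.pairingIn ℤ i k).sum = (t.map fun k ↦ P.pairingIn ℤ i k).sum := by
  have := congrArg (P.root' i) h
  rw [root'_multiset_sum, root'_multiset_sum] at this
  exact_mod_cast this

/-- An element of the coroot lattice on which every root takes a value at most `1` vanishes. -/
lemma multiset_sum_coroot_eq_zero (n : ℕ) : ∀ s : Multiset ι, s.card = n →
    (∀ i, (s.map fun k ↦ P.pairingIn ℤ i k).sum ≤ 1) → (s.map P.coroot).sum = 0 := by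
  classical
  induction n using Nat.strong_induction_on with
  | _ n ih =>
  intro s hs hle
  rcases s.empty_or_exists_mem with rfl | ⟨k, hk⟩
  · simp
  obtain ⟨t, rfl⟩ := Multiset.exists_cons_of_mem hk
  -- A coroot pairing negatively with `k` either cancels it or merges with it into one coroot,
  -- shortening the sum. If there is none, the root `k` already takes a value at least 2.
  by_cases hneg : ∃ l ∈ t, P.pairingIn ℤ k l < 0
  · obtain ⟨l, hl, hneg⟩ := hneg
    obtain ⟨u, rfl⟩ := Multiset.exists_cons_of_mem hl
    simp only [Multiset.card_cons] at hs
    by_cases hkl : P.coroot k = -P.coroot l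
    · have hsum : ((k ::ₘ l ::ₘ u).map P.coroot).sum = (u.map P.coroot).sum := by
        simp [hkl]
      rw [hsum]
      refine ih _ (by lia) u rfl fun i ↦ ?_
      rw [← sum_pairingIn_congr hsum]
      exact hle i
    · have hneg' : P.flip.pairingIn ℤ k l < 0 := by
        rw [P.pairingIn_lt_zero_iff] at hneg
        have h1 := P.flip.algebraMap_pairingIn ℤ k l
        have h2 := P.algebraMap_pairingIn ℤ l k
        rw [RootPairing.pairing_flip, ← h2] at h1
        have h3 : P.flip.pairingIn ℤ k l = P.pairingIn ℤ l k := by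
          simpa using h1
        rw [h3]
        exact hneg
      obtain ⟨m, hm⟩ := P.flip.root_add_root_mem_of_pairingIn_neg hneg' hkl
      have hsum : ((k ::ₘ l ::ₘ u).map P.coroot).sum = ((m ::ₘ u).map P.coroot).sum := by
        have hm : P.coroot m = P.coroot k + P.coroot l := hm
        simp [hm, add_assoc]
      rw [hsum]
      refine ih (u.card + 1) (by lia) (m ::ₘ u) (by simp) fun i ↦ ?_
      rw [← sum_pairingIn_congr hsum]
      exact hle i
  · push Not at hneg
    have h1 := hle k
    rw [Multiset.map_cons, Multiset.sum_cons, P.pairingIn_same] at h1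
    have h2 : (t.map fun _ ↦ (0 : ℤ)).sum ≤ (t.map fun l ↦ P.pairingIn ℤ k l).sum :=
      Multiset.sum_map_le_sum_map _ _ hneg
    simp at h2
    lia

lemma harishChandraStep_mono (Φ₀p Φ₁p : Set ι) : Monotone (harishChandraStep P Φ₀p Φ₁p) :=
  monotone_nat_of_le_succ fun _ ↦ Set.subset_union_left

lemma exists_mem_minElems {Φ₀p Φ₁p : Set ι} {γ : ι} (hγ : γ ∈ harishChandra P Φ₀p Φ₁p) :
    ∃ n, γ ∈ minElems P Φ₀p (Φ₁p \ (harishChandraStep P Φ₀p Φ₁p n ∪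
      shadow P Φ₀p Φ₁p (harishChandraStep P Φ₀p Φ₁p n))) := by
  obtain ⟨n, hn⟩ := Set.mem_iUnion.mp hγ
  induction n with
  | zero => exact hn.elim
  | succ n ih =>
    rcases hn with hn | hn
    exacts [ih hn, ⟨n, hn⟩]

lemma harishChandra_subset (Φ₀p Φ₁p : Set ι) : harishChandra P Φ₀p Φ₁p ⊆ Φ₁p := by
  intro γ hγ
  obtain ⟨n, hn⟩ := exists_mem_minElems hγ
  exact hn.1.1

/-- If `γ` were chosen before `γ'`, then `γ'` would lie in its shadow and be excluded. Otherwise `γ`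
was still available when `γ'` was chosen, against the minimality of `γ'`. -/
lemma root_sub_ne_of_mem_harishChandra {Φ₀p Φ₁p : Set ι} {γ γ' k : ι}
    (hγ : γ ∈ harishChandra P Φ₀p Φ₁p) (hγ' : γ' ∈ harishChandra P Φ₀p Φ₁p) (hk : k ∈ Φ₀p) :
    P.root γ' - P.root γ ≠ P.root k := by
  intro h
  obtain ⟨i, hi⟩ := exists_mem_minElems hγ'
  obtain ⟨j, hj⟩ := exists_mem_minElems hγ
  have hγi : γ ∉ harishChandraStep P Φ₀p Φ₁p i :=
    fun hmem ↦ hi.1.2 (.inr ⟨hi.1.1, γ, hmem, k, hk, h⟩)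
  have hij : i ≤ j := by
    by_contra! hlt
    exact hγi (harishChandraStep_mono Φ₀p Φ₁p hlt (.inr hj))
  have hsub := harishChandraStep_mono (P := P) Φ₀p Φ₁p hij
  have hγ1 : γ ∈ Φ₁p \ (harishChandraStep P Φ₀p Φ₁p i ∪
      shadow P Φ₀p Φ₁p (harishChandraStep P Φ₀p Φ₁p i)) := by
    refine ⟨hj.1.1, ?_⟩
    rintro (hmem | ⟨-, a, ha, l, hl, hal⟩)
    · exact hγi hmem
    · exact hj.1.2 (.inr ⟨hj.1.1, a, hsub ha, l, hl, hal⟩)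
  have := hi.2 γ hγ1 (domLE_of_root_sub hk h.symm)
  rw [this, sub_self] at h
  exact P.ne_zero k h.symm

namespace IsAbelianGrading

variable {d f : M →ₗ[K] K} {Φ₀p Φ₁p : Set ι} (hG : IsAbelianGrading P d f Φ₀p Φ₁p)

include hG

lemma harishChandra_pairwise :
    (harishChandra P Φ₀p Φ₁p).Pairwise fun a c ↦ P.pairingIn ℤ a c = 0 := by
  intro γ hγ γ' hγ' hne
  by_contra h
  rcases hG.exists_pos_sub (harishChandra_subset _ _ hγ) (harishChandra_subset _ _ hγ') hne h with
    ⟨k, hk, h⟩ | ⟨k, hk, h⟩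
  · exact root_sub_ne_of_mem_harishChandra hγ' hγ hk h.symm
  · exact root_sub_ne_of_mem_harishChandra hγ hγ' hk h.symm

lemma degree_sub_sum {S : Finset ι} (hS : (S : Set ι) ⊆ Φ₁p)
    (hS' : (S : Set ι).Pairwise fun a c ↦ P.pairingIn ℤ a c = 0) {i : ι} {m : ℤ}
    (hi : d (P.root i) = m) :
    m - ∑ a ∈ S, P.pairingIn ℤ i a = -1 ∨ m - ∑ a ∈ S, P.pairingIn ℤ i a = 0 ∨
      m - ∑ a ∈ S, P.pairingIn ℤ i a = 1 := by
  obtain ⟨k, hk⟩ := exists_root_eq_sub_sum S hS' i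
  refine hG.degree_eq (i := k) ?_
  rw [hk, map_sub, hi, map_sum]
  push_cast
  congr 1
  refine Finset.sum_congr rfl fun a ha ↦ ?_
  rw [map_zsmul, (hG.mem_one_iff a).mp (hS ha)]
  simp

/-- If some finite set of elements of `Φ₁p` has sum of coroots equal to twice the grading element,
then so does every maximal orthogonal set. -/
lemma sum_pairingIn_eq {S T : Finset ι}
    (hS1 : ∀ α ∈ Φ₁p, ∑ a ∈ S, P.pairingIn ℤ α a = 2)
    (hS0 : ∀ i, d (P.root i) = 0 → ∑ a ∈ S, P.pairingIn ℤ i a = 0)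
    (hT : (T : Set ι) ∈ OrtMax P Φ₁p) (i : ι) :
    ∑ a ∈ T, P.pairingIn ℤ i a = ∑ a ∈ S, P.pairingIn ℤ i a := by
  obtain ⟨h1, h2, h3⟩ := mem_ortMax_iff.mp hT
  have hone (α : ι) (hα : α ∈ Φ₁p) :
      1 ≤ ∑ a ∈ T, P.pairingIn ℤ α a ∧ ∑ a ∈ T, P.pairingIn ℤ α a ≤ 2 := by
    constructor
    · obtain ⟨c, hc, hne⟩ := h3 α hα
      have a1 := Finset.single_le_sum (f := fun a ↦ P.pairingIn ℤ α a)
        (fun a ha ↦ hG.pairingIn_nonneg hα (h1 ha)) (Finset.mem_coe.mp hc)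
      have a2 := hG.pairingIn_nonneg hα (h1 hc)
      lia
    · have := hG.degree_sub_sum h1 h2 (i := α) (m := 1)
        (by simpa using (hG.mem_one_iff α).mp hα)
      lia
  -- `P.reflectionPerm a a` is the index of the negative root, so `s` represents the coroot sum of
  -- `S` minus that of `T`. On roots of degree 1, 0, -1 its values are at most 1, 1, 0.
  set s : Multiset ι := S.val + T.val.map fun a ↦ P.reflectionPerm a a with hs
  have hval (i : ι) : (s.map fun k ↦ P.pairingIn ℤ i k).sum =
      ∑ a ∈ S, P.pairingIn ℤ i a - ∑ a ∈ T, P.pairingIn ℤ i a := by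
    rw [hs, Multiset.map_add, Multiset.sum_add, Multiset.map_map, sub_eq_add_neg,
      ← Finset.sum_neg_distrib]
    congr 2
    refine Multiset.map_congr rfl fun a _ ↦ ?_
    rw [Function.comp_apply, P.pairingIn_reflectionPerm_self_right]
  have hzero := multiset_sum_coroot_eq_zero (P := P) _ s rfl fun i ↦ by
    rw [hval]
    rcases hG.degree_root i with h | h | h
    · obtain ⟨k, hk⟩ := exists_root_eq_neg (P := P) i
      have hk1 : k ∈ Φ₁p := by rw [hG.mem_one_iff, hk, map_neg, h, neg_neg]
      have a1 := hS1 k hk1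
      have a2 := hone k hk1
      simp only [pairingIn_neg hk, Finset.sum_neg_distrib] at a1 a2
      lia
    · have a1 := hS0 i h
      have a2 := hG.degree_sub_sum h1 h2 (i := i) (m := 0) (by simpa using h)
      lia
    · have hi := (hG.mem_one_iff i).mpr h
      have a1 := hS1 i hi
      have a2 := hone i hi
      lia
  have h4 := hval i
  rw [sum_pairingIn_congr (t := 0) (by rw [hzero]; simp)] at h4
  simp at h4
  lia

/-- In the situation of tube type, the product of the reflections in the elements of a maximal
orthogonal antichain preserves the positive roots of degree zero. -/
lemma sub_sum_mem_closure {T : Finset ι} (hT : (T : Set ι) ∈ OrtMax P Φ₁p)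
    (hanti : IsAntichain (DomLE P Φ₀p) (T : Set ι))
    (hT0 : ∀ i, d (P.root i) = 0 → ∑ a ∈ T, P.pairingIn ℤ i a = 0) {x : M}
    (hx : x ∈ AddSubmonoid.closure (P.root '' Φ₀p)) :
    x - ∑ a ∈ T, P.coroot' a x • P.root a ∈ AddSubmonoid.closure (P.root '' Φ₀p) := by
  classical
  obtain ⟨h1, h2, h3⟩ := mem_ortMax_iff.mp hT
  induction hx using AddSubmonoid.closure_induction with
  | zero => simp
  | add x y _ _ hx hy =>
    have := add_mem hx hy
    convert this using 1
    simp only [map_add, add_smul, Finset.sum_add_distrib]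
    abel
  | mem x hx =>
    obtain ⟨k, hk, rfl⟩ := hx
    have hkd := hG.degree_zero k hk
    simp only [coroot'_root, Int.cast_smul_eq_zsmul]
    obtain ⟨l, hl⟩ := exists_root_eq_sub_sum T h2 k
    rw [← hl]
    have hld : d (P.root l) = 0 := by
      have h5 := hT0 k hkd
      rw [hl, map_sub, map_sum, hkd, zero_sub, neg_eq_zero]
      rw [← Int.cast_zero, ← h5, Int.cast_sum]
      refine Finset.sum_congr rfl fun a ha ↦ ?_
      rw [map_zsmul, (hG.mem_one_iff a).mp (h1 ha)]
      simp
    rcases hG.pos_or_neg l hld with hlΦ | ⟨e, he, hel⟩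
    · exact AddSubmonoid.subset_closure ⟨l, hlΦ, rfl⟩
    exfalso
    have hsum : P.root k + P.root e = ∑ a ∈ T, P.pairingIn ℤ k a • P.root a := by
      rw [hel, hl]; abel
    by_cases hall : ∀ a ∈ T, P.pairingIn ℤ k a = 0
    · rw [Finset.sum_eq_zero fun a ha ↦ by rw [hall a ha, zero_smul]] at hsum
      have := hG.eq_zero_of_mem_of_neg_mem (AddSubmonoid.subset_closure ⟨k, hk, rfl⟩)
        (by rw [neg_eq_of_add_eq_zero_right hsum]; exact AddSubmonoid.subset_closure ⟨e, he, rfl⟩)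
      exact P.ne_zero k this
    push Not at hall
    -- The pairings of `k` with `T` sum to zero and each sign occurs at most once, so nonzero ones
    -- come as a single pair 1, -1.
    have hex : ∀ a ∈ T, P.pairingIn ℤ k a ≠ 0 →
        ∃ c ∈ T, P.pairingIn ℤ k c = -P.pairingIn ℤ k a := by
      intro a ha hne
      by_contra! hcon
      have h5 := hT0 k hkd
      rw [Finset.sum_eq_single a] at h5
      · exact hne h5
      · intro c hc hca
        have a1 := hG.pairingIn_ne_of_eq hkd (h1 ha) (h1 hc) hca.symm (h2 ha hc hca.symm) hne
        have a2 := hcon c hc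
        have a3 := hG.abs_pairingIn_le_one hkd (h1 hc)
        have a4 := hG.abs_pairingIn_le_one hkd (h1 ha)
        lia
      · exact fun h ↦ absurd ha h
    obtain ⟨a, ha, c, hc, hpa, hpc⟩ : ∃ a ∈ T, ∃ c ∈ T,
        P.pairingIn ℤ k a = 1 ∧ P.pairingIn ℤ k c = -1 := by
      obtain ⟨a, ha, hne⟩ := hall
      obtain ⟨c, hc, hac⟩ := hex a ha hne
      have a1 := hG.abs_pairingIn_le_one hkd (h1 ha)
      rcases (show P.pairingIn ℤ k a = 1 ∨ P.pairingIn ℤ k a = -1 by lia) with h | h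
      · exact ⟨a, ha, c, hc, h, by lia⟩
      · exact ⟨c, hc, a, ha, by lia, h⟩
    have hac : a ≠ c := by rintro rfl; lia
    have hsum2 : ∑ b ∈ T, P.pairingIn ℤ k b • P.root b = P.root a - P.root c := by
      rw [← Finset.sum_subset (s₁ := {a, c}) (by
        simp [Finset.insert_subset_iff, ha, hc])]
      · rw [Finset.sum_pair hac, hpa, hpc]
        simp [sub_eq_add_neg]
      · intro b hb hbn
        simp only [Finset.mem_insert, Finset.mem_singleton, not_or] at hbn
        have a1 := hG.pairingIn_ne_of_eq hkd (h1 ha) (h1 hb) (Ne.symm hbn.1)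
          (h2 ha hb (Ne.symm hbn.1)) (by lia)
        have a2 := hG.pairingIn_ne_of_eq hkd (h1 hc) (h1 hb) (Ne.symm hbn.2)
          (h2 hc hb (Ne.symm hbn.2)) (by lia)
        have a3 := hG.abs_pairingIn_le_one hkd (h1 hb)
        rw [show P.pairingIn ℤ k b = 0 by lia, zero_smul]
    -- If the image of `k` were negative, `k + e = a - c` would be a sum of positive roots, making
    -- `c` and `a` comparable.
    refine hanti hc ha hac.symm (?_ : P.root a - P.root c ∈ _)
    rw [← hsum2, ← hsum]
    exact add_mem (AddSubmonoid.subset_closure ⟨k, hk, rfl⟩)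
      (AddSubmonoid.subset_closure ⟨e, he, rfl⟩)

/-- In the situation of tube type, a maximal orthogonal antichain is the set of all elements that
have as many elements above as below. -/
lemma eq_setOf_ncard_eq {T : Finset ι} (hT : (T : Set ι) ∈ OrtMax P Φ₁p)
    (hanti : IsAntichain (DomLE P Φ₀p) (T : Set ι))
    (hT1 : ∀ α ∈ Φ₁p, ∑ a ∈ T, P.pairingIn ℤ α a = 2)
    (hT0 : ∀ i, d (P.root i) = 0 → ∑ a ∈ T, P.pairingIn ℤ i a = 0) :
    (T : Set ι) = {α ∈ Φ₁p | {x ∈ Φ₁p | DomLE P Φ₀p x α}.ncard =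
      {x ∈ Φ₁p | DomLE P Φ₀p α x}.ncard} := by
  classical
  obtain ⟨h1, h2, h3⟩ := mem_ortMax_iff.mp hT
  set r : M → M := fun x ↦ x - ∑ a ∈ T, P.coroot' a x • P.root a with hr
  have hex (i : ι) : ∃ k, P.root k = -r (P.root i) := by
    obtain ⟨l, hl⟩ := exists_root_eq_sub_sum T h2 i
    obtain ⟨k, hk⟩ := exists_root_eq_neg (P := P) l
    refine ⟨k, ?_⟩
    simp only [hr, coroot'_root, Int.cast_smul_eq_zsmul]
    rw [hk, hl]
  -- `τ` is minus the product of the reflections in `T`: on `Φ₁p` the degree becomes `-(1 - 2) = 1`,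
  -- and each element of `T` is fixed.
  choose τ hτ using hex
  have hrsub (x y : M) : r (x - y) = r x - r y := by
    simp only [hr, map_sub, sub_smul, Finset.sum_sub_distrib]
    abel
  have hrneg (x : M) : r (-x) = -r x := by
    have := hrsub 0 x
    rwa [zero_sub, show r 0 = 0 by simp [hr], zero_sub] at this
  have hcor (c : ι) (hc : c ∈ T) (x : M) : P.coroot' c (r x) = -P.coroot' c x := by
    simp only [hr, map_sub, map_sum, map_smul]
    rw [Finset.sum_eq_single c]
    · rw [coroot'_root, P.pairingIn_same, smul_eq_mul]
      push_cast
      ring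
    · intro b hb hbc
      rw [coroot'_root, h2 hb hc hbc]
      simp
    · exact fun h ↦ absurd hc h
  have hrr (x : M) : r (r x) = x := by
    change r x - ∑ a ∈ T, P.coroot' a (r x) • P.root a = x
    rw [Finset.sum_congr rfl fun c hc ↦ by rw [hcor c hc x, neg_smul], Finset.sum_neg_distrib,
      sub_neg_eq_add]
    simp [hr]
  have hττ (i : ι) : τ (τ i) = i := by
    apply P.root.injective
    rw [hτ, hτ, hrneg, hrr, neg_neg]
  have hτfix (a : ι) (ha : a ∈ T) : τ a = a := by
    apply P.root.injective
    rw [hτ]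
    simp only [hr, coroot'_root]
    rw [Finset.sum_eq_single a]
    · rw [P.pairingIn_same, Int.cast_ofNat, two_smul]
      abel
    · intro b hb hba
      rw [h2 ha hb hba.symm]
      simp
    · exact fun h ↦ absurd ha h
  have hτ1 (α : ι) (hα : α ∈ Φ₁p) : τ α ∈ Φ₁p := by
    have h5 := hT1 α hα
    rw [hG.mem_one_iff] at hα ⊢
    rw [hτ]
    have h6 : d (∑ a ∈ T, P.coroot' a (P.root α) • P.root a) = 2 := by
      rw [← Int.cast_ofNat, ← h5, Int.cast_sum, map_sum]
      refine Finset.sum_congr rfl fun a ha ↦ ?_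
      rw [map_smul, coroot'_root, (hG.mem_one_iff a).mp (h1 ha), smul_eq_mul, mul_one]
    rw [map_neg, map_sub, h6, hα]
    norm_num
  have hτle (α β : ι) (h : DomLE P Φ₀p α β) : DomLE P Φ₀p (τ β) (τ α) := by
    have := hG.sub_sum_mem_closure hT hanti hT0 h
    rw [DomLE, hτ, hτ, neg_sub_neg, ← hrsub]
    exact this
  have hinj : Function.Injective τ := fun x y h ↦ by rw [← hττ x, h, hττ]
  -- By maximality of `T`, it suffices that the balanced elements are pairwise orthogonal and
  -- include `T`. Going strictly up adds elements below and loses elements above, so no two balanced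
  -- elements are comparable.
  refine hT.eq_of_subset (mem_ort_iff.mpr ⟨fun x hx ↦ hx.1, ?_⟩) fun a ha ↦ ⟨h1 ha, ?_⟩
  · rintro α ⟨hα, hα'⟩ β ⟨hβ, hβ'⟩ hne
    by_contra h
    rcases hG.domLE_or_domLE hα hβ h with hle | hle
    · have a1 := hG.ncard_below_lt hβ hle hne
      have a2 := hG.ncard_above_lt hα hle hne
      lia
    · have a1 := hG.ncard_below_lt hα hle hne.symm
      have a2 := hG.ncard_above_lt hβ hle hne.symm
      lia
  · apply le_antisymm
    · refine Set.ncard_le_ncard_of_injOn τ (fun x hx ↦ ⟨hτ1 x hx.1, ?_⟩) hinj.injOn (Set.toFinite _)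
      have := hτle x a hx.2
      rwa [hτfix a ha] at this
    · refine Set.ncard_le_ncard_of_injOn τ (fun x hx ↦ ⟨hτ1 x hx.1, ?_⟩) hinj.injOn (Set.toFinite _)
      have := hτle a x hx.2
      rwa [hτfix a ha] at this

end IsAbelianGrading

end Tube

/-! ### Climbing in the degree 1 part by single roots of degree 0 -/

section Ladder

variable {ι K M N : Type*} [Finite ι] [Field K] [CharZero K] [AddCommGroup M] [Module K M]
  [AddCommGroup N] [Module K N] {P : RootPairing ι K M N} [P.IsCrystallographic]
  {d f : M →ₗ[K] K} {Φ₀p Φ₁p : Set ι}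

namespace IsAbelianGrading

variable (hG : IsAbelianGrading P d f Φ₀p Φ₁p)

include hG

/-- A pairing of at least 3 would force the reverse pairing to be 1. Then `η - δ` is a root of
degree 1 with the same pairing from `η`, beyond the bound 2 in `Φ₁p`. -/
lemma pairingIn_degree_zero_le_two {η δ : ι} (hη : η ∈ Φ₁p) (hδ : d (P.root δ) = 0) :
    P.pairingIn ℤ η δ ≤ 2 := by
  by_contra! h
  have h1 : P.pairingIn ℤ δ η = 1 := by
    have a1 := hG.abs_pairingIn_le_one hδ hη
    have a2 := pairingIn_pos_comm.mp (show 0 < P.pairingIn ℤ η δ by lia)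
    lia
  obtain ⟨κ, hκ⟩ := exists_root_eq_neg (P := P) (P.reflectionPerm η δ)
  have h2 := pairingIn_neg_right hκ η
  rw [P.pairingIn_reflectionPerm, P.pairingIn_reflectionPerm_self_left] at h2
  rw [root_reflectionPerm_eq, h1, one_smul, neg_sub] at hκ
  have h3 := hG.pairingIn_le_two hη (hG.sub_mem_one hη hδ hκ)
  lia

lemma neg_two_le_pairingIn_degree_zero {η δ : ι} (hη : η ∈ Φ₁p) (hδ : d (P.root δ) = 0) :
    -2 ≤ P.pairingIn ℤ η δ := by
  obtain ⟨κ, hκ⟩ := exists_root_eq_neg (P := P) δ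
  have h1 := hG.pairingIn_degree_zero_le_two hη (δ := κ) (by rw [hκ, map_neg, hδ, neg_zero])
  rw [pairingIn_neg_right hκ] at h1
  lia

/-- Either `α - β` is itself a single step, or `α` is orthogonal to `β`; then some summand of `α -
β` can be subtracted from `α` without leaving `Φ₁p`. -/
lemma ladder_induction {p : ι → Prop}
    (step : ∀ α ∈ Φ₁p, ∀ γ ∈ Φ₁p, ∀ k ∈ Φ₀p, P.root k = P.root α - P.root γ → p γ → p α)
    {β : ι} (hβ : β ∈ Φ₁p) (hpβ : p β) (n : ℕ) : ∀ s : Multiset ι, s.card = n →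
    (∀ k ∈ s, k ∈ Φ₀p) → ∀ α ∈ Φ₁p, P.root α - P.root β = (s.map P.root).sum → p α := by
  classical
  induction n with
  | zero =>
    intro s hs _ α _ hsum
    rw [Multiset.card_eq_zero.mp hs, Multiset.map_zero, Multiset.sum_zero, sub_eq_zero] at hsum
    exact P.root.injective hsum ▸ hpβ
  | succ n ih =>
    intro s hs hsΦ α hα hsum
    rcases eq_or_ne α β with rfl | hne
    · exact hpβ
    rcases (hG.pairingIn_nonneg hα hβ).lt_or_eq with hpos | hzero
    · obtain ⟨k, hk⟩ := P.root_sub_root_mem_of_pairingIn_pos hpos hne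
      have hkd : d (P.root k) = 0 := by
        rw [hk, map_sub, (hG.mem_one_iff _).mp hα, (hG.mem_one_iff _).mp hβ, sub_self]
      exact step α hα β hβ k
        (hG.domLE_pos (domLE_iff_exists_multiset.mpr ⟨s, hsΦ, hsum⟩) hk hkd) hk hpβ
    obtain ⟨ε, hεs, hε⟩ : ∃ ε ∈ s, 0 < P.pairingIn ℤ ε α := by
      by_contra! hcon
      have h1 := pairingIn_multiset_sum s hsum α
      rw [P.pairingIn_same, pairingIn_zero_comm.mp hzero.symm] at h1
      have h2 : (s.map fun k ↦ P.pairingIn ℤ k α).sum ≤ (s.map fun _ ↦ (0 : ℤ)).sum :=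
        Multiset.sum_map_le_sum_map _ _ hcon
      simp at h2
      lia
    have hεd := hG.degree_zero ε (hsΦ ε hεs)
    have hαε : α ≠ ε := by
      rintro rfl
      rw [hG.mem_one_iff, hεd] at hα
      exact zero_ne_one hα
    obtain ⟨γ, hγ⟩ := P.root_sub_root_mem_of_pairingIn_pos (pairingIn_pos_comm.mp hε) hαε
    have hγΦ := hG.sub_mem_one hα hεd hγ
    refine step α hα γ hγΦ ε (hsΦ ε hεs) (by rw [hγ]; abel) ?_
    refine ih (s.erase ε) (by rw [Multiset.card_erase_of_mem hεs, hs]; rfl)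
      (fun k hk ↦ hsΦ k (Multiset.mem_of_mem_erase hk)) γ hγΦ ?_
    rw [← Multiset.cons_erase hεs, Multiset.map_cons, Multiset.sum_cons] at hsum
    rw [hγ, sub_right_comm, hsum]
    abel

end IsAbelianGrading

end Ladder

/-! ### Coefficients and heights with respect to a base -/

section Base

variable {ι K M N : Type*} [Finite ι] [Field K] [CharZero K] [AddCommGroup M] [Module K M]
  [AddCommGroup N] [Module K N] {P : RootPairing ι K M N} [P.IsRootSystem] (b : P.Base)

lemma exists_repr_eq_natCast {x : M} (hx : x ∈ AddSubmonoid.closure (P.root '' b.support))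
    (j : b.support) : ∃ n : ℕ, b.toWeightBasis.repr x j = n := by
  classical
  induction hx using AddSubmonoid.closure_induction with
  | mem x hx =>
    obtain ⟨i, hi, rfl⟩ := hx
    have := b.toWeightBasis_repr_root ⟨i, hi⟩
    simp only at this
    rw [this, Finsupp.single_apply]
    split_ifs
    · exact ⟨1, by simp⟩
    · exact ⟨0, by simp⟩
  | zero => exact ⟨0, by simp⟩
  | add x y _ _ hx hy =>
    obtain ⟨n, hn⟩ := hx
    obtain ⟨m, hm⟩ := hy
    exact ⟨n + m, by simp [hn, hm]⟩

/-- The sum of the coefficients with respect to the simple roots. -/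
noncomputable def heightFunctional : M →ₗ[K] K := ∑ j : b.support, b.toWeightBasis.coord j

lemma heightFunctional_root (i : ι) : heightFunctional b (P.root i) = (b.height i : K) := by
  classical
  have hsimple (j : ι) (hj : j ∈ b.support) : heightFunctional b (P.root j) = 1 := by
    have := b.toWeightBasis_repr_root ⟨j, hj⟩
    simp only at this
    simp [heightFunctional, this, Finsupp.single_apply]
  obtain ⟨g, -, -, hg⟩ := b.exists_root_eq_sum_int i
  rw [b.height_eq_sum hg, hg, map_sum]
  push_cast
  refine Finset.sum_congr rfl fun j hj ↦ ?_
  rw [map_zsmul, hsimple j hj]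
  simp

lemma isPos_iff_mem_closure (i : ι) :
    b.IsPos i ↔ P.root i ∈ AddSubmonoid.closure (P.root '' b.support) := by
  have key {x : M} (hx : x ∈ AddSubmonoid.closure (P.root '' b.support)) :
      ∃ n : ℕ, heightFunctional b x = n := by
    choose n hn using exists_repr_eq_natCast b hx
    exact ⟨∑ j, n j, by simp [heightFunctional, hn]⟩
  have hne := b.height_ne_zero i
  rw [RootPairing.Base.isPos_iff]
  constructor
  · intro h
    refine (b.root_mem_or_neg_mem i).resolve_right fun hneg ↦ ?_
    obtain ⟨n, hn⟩ := key hneg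
    rw [map_neg, heightFunctional_root] at hn
    have : -b.height i = n := by exact_mod_cast hn
    lia
  · intro h
    obtain ⟨n, hn⟩ := key h
    rw [heightFunctional_root] at hn
    have : b.height i = n := by exact_mod_cast hn
    lia

/-- Comparing `θ` with both a root and its negative bounds the integral coefficient by 1 in absolute
value. -/
lemma coeff_eq_of_isHighestRoot [P.IsCrystallographic] {q : b.support} {θ : ι} (hθ : IsHighestRoot b θ)
    (hq : coeff b q θ = 1) (i : ι) : coeff b q i = -1 ∨ coeff b q i = 0 ∨ coeff b q i = 1 := by
  obtain ⟨k, hk⟩ := exists_root_eq_neg (P := P) i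
  obtain ⟨n, hn⟩ := exists_repr_eq_natCast b (hθ i) q
  obtain ⟨m, hm⟩ := exists_repr_eq_natCast b (hθ k) q
  rw [hk, sub_neg_eq_add, map_add, Finsupp.add_apply] at hm
  rw [map_sub, Finsupp.sub_apply] at hn
  simp only [coeff] at hq ⊢
  rw [hq] at hn hm
  have hc : b.toWeightBasis.repr (P.root i) q = ((1 - n : ℤ) : K) := by
    push_cast; rw [← hn]; ring
  rw [hc] at hm ⊢
  have : (1 : ℤ) + (1 - n) = m := by exact_mod_cast hm
  norm_cast
  lia

end Base

/-! ### Root spaces and stable subalgebras -/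

section Lie

variable {L : Type*} [LieRing L] [LieAlgebra ℂ L] [FiniteDimensional ℂ L] [IsSimple ℂ L]
  {H : LieSubalgebra ℂ L} [H.IsCartanSubalgebra]

lemma exists_mem_rootSpace_ne_zero (β : H.root) : ∃ x ∈ rootSpace H β, x ≠ 0 :=
  β.1.exists_ne_zero

lemma exists_root_of_rootSpace_ne_bot {χ : Dual ℂ H} (hχ : χ ≠ 0)
    (h : rootSpace H (χ : H → ℂ) ≠ ⊥) : ∃ η : H.root, (rootSystem H).root η = χ := by
  let w : LieModule.Weight ℂ H L := ⟨χ, h⟩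
  have hw : w.IsNonZero := fun h0 ↦ hχ (by
    ext t
    exact congrFun h0 t)
  exact ⟨⟨w, by simpa [LieSubalgebra.root] using hw⟩, by ext t; rfl⟩

lemma lie_eq_pairingIn_smul (α k : H.root) {x : L} (hx : x ∈ rootSpace H α) :
    ⁅((coroot k.1 : H) : L), x⁆ = ((rootSystem H).pairingIn ℤ α k : ℂ) • x := by
  have h1 := lie_eq_smul_of_mem_rootSpace hx (coroot k.1)
  have h2 : ((rootSystem H).pairingIn ℤ α k : ℂ) = α.1 (coroot k.1) := by
    rw [← rootSystem_pairing_apply, ← (rootSystem H).algebraMap_pairingIn ℤ]; simp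
  rw [h2]
  exact h1

/-- This amounts to `[𝔤^k, 𝔤^β] = 𝔤^α`, seen in the `sl₂`-triple of `k`, where pairings of degree 1
roots with `k` lie between -2 and 2. -/
lemma rootSpace_le_of_root_sub {d f : Dual ℂ H →ₗ[ℂ] ℂ} {Φ₀p Φ₁p : Set H.root}
    (hG : IsAbelianGrading (rootSystem H) d f Φ₀p Φ₁p) {α β k : H.root}
    (hα : α ∈ Φ₁p) (hβ : β ∈ Φ₁p) (hk : d ((rootSystem H).root k) = 0)
    (h : (rootSystem H).root k = (rootSystem H).root α - (rootSystem H).root β)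
    {S : Submodule ℂ L} (hS : ∀ y ∈ rootSpace H β, y ∈ S)
    (hstab : ∀ e ∈ rootSpace H k, ∀ y ∈ S, ⁅e, y⁆ ∈ S) : ∀ x ∈ rootSpace H α, x ∈ S := by
  intro x hx
  have hknz : k.1.IsNonZero := H.isNonZero_coe_root k
  obtain ⟨h', e, f', ht, he, hf⟩ := exists_isSl2Triple_of_weight_isNonZero hknz
  obtain rfl := ht.h_eq_coroot hknz he hf
  have hfun : (k : H → ℂ) = (α : H → ℂ) - (β : H → ℂ) := by
    ext t
    exact LinearMap.congr_fun h t
  have dα := (hG.mem_one_iff α).mp hα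
  have dβ := (hG.mem_one_iff β).mp hβ
  have hpβ : (rootSystem H).pairingIn ℤ β k = (rootSystem H).pairingIn ℤ α k - 2 := by
    have := pairingIn_sub h k
    rw [(rootSystem H).pairingIn_same] at this
    lia
  -- In the first case `α + k` is not a root, so `e` kills `x` and `[e, [f', x]]` is a nonzero
  -- multiple of `x`. In the second `β - k` is not a root, so `f'` kills `y`, which makes `[e, y]`
  -- nonzero and a generator of the line `𝔤^α`.
  by_cases hp : 1 ≤ (rootSystem H).pairingIn ℤ α k
  · have hex : ⁅e, x⁆ = 0 := by
      have hmem := lie_mem_genWeightSpace_of_mem_genWeightSpace he hx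
      by_contra hne
      have hχ : d ((rootSystem H).root k + (rootSystem H).root α) = 1 := by
        rw [map_add, hk, dα, zero_add]
      obtain ⟨η, hη⟩ := exists_root_of_rootSpace_ne_bot (H := H)
        (χ := (rootSystem H).root k + (rootSystem H).root α)
        (fun h0 ↦ by rw [h0, map_zero] at hχ; exact zero_ne_one hχ)
        (fun hbot ↦ hne (by
          have hmem' : ⁅e, x⁆ ∈ rootSpace H
            (((rootSystem H).root k + (rootSystem H).root α : Dual ℂ H) : H → ℂ) := hmem
          rw [hbot] at hmem'
          simpa using hmem'))
      have h1 := hG.pairingIn_degree_zero_le_two (η := η) (δ := k)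
        ((hG.mem_one_iff η).mpr (by rw [hη, hχ])) hk
      rw [RootPairing.pairingIn_eq_add_of_root_eq_add hη, (rootSystem H).pairingIn_same] at h1
      lia
    have hfx : ⁅f', x⁆ ∈ rootSpace H β := by
      have hmem := lie_mem_genWeightSpace_of_mem_genWeightSpace hf hx
      have e1 : (-(k : H → ℂ) + (α : H → ℂ)) = β := by rw [hfun]; abel
      rwa [← e1]
    have key : ⁅e, ⁅f', x⁆⁆ = ((rootSystem H).pairingIn ℤ α k : ℂ) • x := by
      rw [leibniz_lie, ht.lie_e_f, hex, lie_zero, add_zero, lie_eq_pairingIn_smul α k hx]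
    have hne : ((rootSystem H).pairingIn ℤ α k : ℂ) ≠ 0 := by
      norm_cast; lia
    rw [← inv_smul_smul₀ hne x, ← key]
    exact S.smul_mem _ (hstab e he _ (hS _ hfx))
  · obtain ⟨y, hy, hy0⟩ := exists_mem_rootSpace_ne_zero β
    have hfy : ⁅f', y⁆ = 0 := by
      have hmem := lie_mem_genWeightSpace_of_mem_genWeightSpace hf hy
      by_contra hne
      have hχ : d (-(rootSystem H).root k + (rootSystem H).root β) = 1 := by
        rw [map_add, map_neg, hk, dβ, neg_zero, zero_add]
      obtain ⟨η, hη⟩ := exists_root_of_rootSpace_ne_bot (H := H)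
        (χ := -(rootSystem H).root k + (rootSystem H).root β)
        (fun h0 ↦ by rw [h0, map_zero] at hχ; exact zero_ne_one hχ)
        (fun hbot ↦ hne (by
          have hmem' : ⁅f', y⁆ ∈ rootSpace H
            ((-(rootSystem H).root k + (rootSystem H).root β : Dual ℂ H) : H → ℂ) := hmem
          rw [hbot] at hmem'
          simpa using hmem'))
      have h1 := hG.neg_two_le_pairingIn_degree_zero (η := η) (δ := k)
        ((hG.mem_one_iff η).mpr (by rw [hη, hχ])) hk
      rw [pairingIn_sub (show _ = (rootSystem H).root β - (rootSystem H).root k by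
        rw [hη]; abel), (rootSystem H).pairingIn_same] at h1
      lia
    have hey : ⁅e, y⁆ ∈ rootSpace H α := by
      have hmem := lie_mem_genWeightSpace_of_mem_genWeightSpace he hy
      have e1 : ((k : H → ℂ) + (β : H → ℂ)) = α := by rw [hfun]; abel
      rwa [← e1]
    have key : ⁅f', ⁅e, y⁆⁆ = -((rootSystem H).pairingIn ℤ β k : ℂ) • y := by
      rw [leibniz_lie, hfy, lie_zero, add_zero, ← lie_skew f' e, ht.lie_e_f, neg_lie,
        lie_eq_pairingIn_smul β k hy, neg_smul]
    have hne : ⁅e, y⁆ ≠ 0 := by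
      intro h0
      rw [h0, lie_zero] at key
      rcases smul_eq_zero.mp key.symm with h2 | h2
      · norm_cast at h2; lia
      · exact hy0 h2
    have hrank := finrank_rootSpace_eq_one α.1
      (H.isNonZero_coe_root α)
    obtain ⟨c, hc⟩ := (finrank_eq_one_iff_of_nonzero' (⟨⁅e, y⁆, hey⟩ : rootSpace H α.1)
      (fun h0 ↦ hne (congrArg Subtype.val h0))).mp hrank ⟨x, hx⟩
    have hc' : c • ⁅e, y⁆ = x := congrArg Subtype.val hc
    rw [← hc']
    exact S.smul_mem _ (hstab e he _ (hS y hy))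

variable {b : (rootSystem H).Base} {q : b.support} {σ : L ≃ₗ⁅ℂ⁆ L}

lemma eq_zero_of_eq_neg_self {x : L} (h : x = -x) : x = 0 := by
  have h2 : (2 : ℂ) • x = 0 := by
    rw [two_smul]; nth_rewrite 2 [h]; exact add_neg_cancel x
  exact (smul_eq_zero.mp h2).resolve_left two_ne_zero

lemma IsHermitianInvolution.mem_Phi₀_iff (hσ : IsHermitianInvolution b q σ) (β : H.root) :
    β ∈ Phi₀ H σ ↔ coeff b q β = 0 := by
  constructor
  · rintro ⟨x, hx, hx0, hσx⟩
    by_contra h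
    exact hx0 (eq_zero_of_eq_neg_self (hσx.symm.trans (hσ.nilradical β h x hx)))
  · intro h
    obtain ⟨x, hx, hx0⟩ := exists_mem_rootSpace_ne_zero β
    exact ⟨x, hx, hx0, hσ.levi β h x hx⟩

lemma IsHermitianInvolution.mem_Phi₁_iff (hσ : IsHermitianInvolution b q σ) (β : H.root) :
    β ∈ Phi₁ H σ ↔ coeff b q β ≠ 0 := by
  constructor
  · rintro ⟨x, hx, hx0, hσx⟩ h
    exact hx0 (eq_zero_of_eq_neg_self ((hσ.levi β h x hx).symm.trans hσx))
  · intro h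
    obtain ⟨x, hx, hx0⟩ := exists_mem_rootSpace_ne_zero β
    exact ⟨x, hx, hx0, hσ.nilradical β h x hx⟩

lemma IsHermitianInvolution.isAbelianGrading (hσ : IsHermitianInvolution b q σ) :
    IsAbelianGrading (rootSystem H) (b.toWeightBasis.coord q) (heightFunctional b)
      (Phi₀Pos b σ) (Phi₁Pos b σ) where
  degree_root i := by
    obtain ⟨θ, hθ, hq⟩ := hσ.coeff_highest
    exact coeff_eq_of_isHighestRoot b hθ hq i
  mem_one_iff i := by
    obtain ⟨θ, hθ, hq⟩ := hσ.coeff_highest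
    have h1 := coeff_eq_of_isHighestRoot b hθ hq i
    change _ ∧ _ ↔ coeff b q i = 1
    rw [hσ.mem_Phi₁_iff, isPos_iff_mem_closure]
    constructor
    · rintro ⟨h0, hpos⟩
      obtain ⟨n, hn⟩ := exists_repr_eq_natCast b hpos q
      rcases h1 with h | h | h
      · have : (n : ℂ) = -1 := hn.symm.trans h
        have : (n : ℤ) = -1 := by exact_mod_cast this
        lia
      · exact absurd h h0
      · exact h
    · intro h
      refine ⟨by rw [h]; exact one_ne_zero, (b.root_mem_or_neg_mem i).resolve_right fun hneg ↦ ?_⟩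
      obtain ⟨n, hn⟩ := exists_repr_eq_natCast b hneg q
      rw [map_neg, Finsupp.neg_apply, show b.toWeightBasis.repr ((rootSystem H).root i) q = 1
        from h] at hn
      have : -1 = (n : ℤ) := by exact_mod_cast hn
      lia
  degree_zero i hi := (hσ.mem_Phi₀_iff i).mp hi.1
  pos_or_neg i hi := by
    have hi : coeff b q i = 0 := hi
    by_cases hpos : b.IsPos i
    · exact .inl ⟨(hσ.mem_Phi₀_iff i).mpr hi, hpos⟩
    · obtain ⟨j, hj⟩ := exists_root_eq_neg (P := rootSystem H) i
      refine .inr ⟨j, ⟨(hσ.mem_Phi₀_iff _).mpr ?_, ?_⟩, hj⟩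
      · simp only [coeff] at hi ⊢
        rw [hj, map_neg, Finsupp.neg_apply, hi, neg_zero]
      · have h1 := b.height_ne_zero i
        have h2 := heightFunctional_root b j
        rw [hj, map_neg, heightFunctional_root] at h2
        have h2 : -b.height i = b.height j := by exact_mod_cast h2
        rw [RootPairing.Base.isPos_iff] at hpos ⊢
        lia
  height_pos i hi := by
    have hpos : 0 < b.height i := hi.2
    obtain ⟨n, hn⟩ := Int.eq_ofNat_of_zero_le hpos.le
    exact ⟨n, by lia, by rw [heightFunctional_root, hn]; simp⟩

lemma IsHermitianInvolution.turnstile_of_subset_upClosure (hσ : IsHermitianInvolution b q σ)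
    {A B : Set H.root} (hB : B ⊆ Phi₁Pos b σ)
    (hAB : A ⊆ upClosure (rootSystem H) (Phi₀Pos b σ) (Phi₁Pos b σ) B) : Turnstile b σ A B := by
  have hG := hσ.isAbelianGrading
  refine le_sInf fun S hS ↦ sInf_le ⟨fun a ha ↦ ?_, hS.2⟩
  obtain ⟨ha1, β, hβ, hle⟩ := hAB ha
  obtain ⟨s, hs, hsum⟩ := domLE_iff_exists_multiset.mp hle
  refine hG.ladder_induction (p := fun γ ↦ ∀ x ∈ rootSpace H γ, x ∈ S) ?_ (hB hβ) (hS.1 β hβ)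
    _ s rfl hs a ha1 hsum
  intro α hα γ hγ k hk h hγS
  refine rootSpace_le_of_root_sub hG hα hγ (hG.degree_zero k hk) h (S := S.toSubmodule) hγS
    fun e he y hy ↦ hS.2 e ?_ y hy
  refine Submodule.mem_sup_right ?_
  exact Submodule.mem_iSup_of_mem k (Submodule.mem_iSup_of_mem hk he)

end Lie

end HermitianPair

/-! ### Assembly of existence, uniqueness and the two comparisons -/

theorem mainTheorem9 {L : Type*} [LieRing L] [LieAlgebra ℂ L] [FiniteDimensional ℂ L]
    [LieAlgebra.IsSimple ℂ L] (H : LieSubalgebra ℂ L) [H.IsCartanSubalgebra]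
    (b : (LieAlgebra.IsKilling.rootSystem H).Base) (q : b.support) (σ : L ≃ₗ⁅ℂ⁆ L)
    (hσ : HermitianPair.IsHermitianInvolution b q σ) (htube : HermitianPair.IsTubeType b σ) :
    ∃ A : Set H.root,
      (A ∈ HermitianPair.OrtMax (LieAlgebra.IsKilling.rootSystem H) (HermitianPair.Phi₁Pos b σ) ∧
        IsAntichain (HermitianPair.DomLE (LieAlgebra.IsKilling.rootSystem H)
          (HermitianPair.Phi₀Pos b σ)) A) ∧
      (∀ A' ∈ HermitianPair.OrtMax (LieAlgebra.IsKilling.rootSystem H)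
          (HermitianPair.Phi₁Pos b σ),
        IsAntichain (HermitianPair.DomLE (LieAlgebra.IsKilling.rootSystem H)
          (HermitianPair.Phi₀Pos b σ)) A' → A' = A) ∧
      ∀ B ∈ HermitianPair.OrtMax (LieAlgebra.IsKilling.rootSystem H)
          (HermitianPair.Phi₁Pos b σ),
        HermitianPair.Turnstile b σ A B ∧
        A ⊆ HermitianPair.upClosure (LieAlgebra.IsKilling.rootSystem H)
          (HermitianPair.Phi₀Pos b σ) (HermitianPair.Phi₁Pos b σ) B := by
  classical
  open HermitianPair in
  have hG := hσ.isAbelianGrading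
  set S : Finset H.root :=
    (Set.toFinite (harishChandra (rootSystem H) (Phi₀Pos b σ) (Phi₁Pos b σ))).toFinset with hS
  -- Every Harish-Chandra root equals 2 on `t`, so the tube type conditions evaluated at `t` give 2
  -- on `Φ₁⁺` and 0 on `Φ₀`.
  set t : H := ∑ a ∈ S, (rootSystem H).coroot a with ht
  have htmem : t ∈ tMinus (rootSystem H) (Phi₀Pos b σ) (Phi₁Pos b σ) :=
    Submodule.sum_mem _ fun a ha ↦ Submodule.subset_span ⟨a, by simpa [hS] using ha, rfl⟩
  have hval (i : H.root) : (rootSystem H).root i t =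
      ((∑ a ∈ S, (rootSystem H).pairingIn ℤ i a : ℤ) : ℂ) := by
    rw [ht, map_sum, Int.cast_sum]
    exact Finset.sum_congr rfl fun a _ ↦ root'_coroot (P := rootSystem H) i a
  have hγ (γ : H.root) (hγ : γ ∈ harishChandra (rootSystem H) (Phi₀Pos b σ) (Phi₁Pos b σ)) :
      (rootSystem H).root γ t = 2 := by
    rw [hval, Finset.sum_eq_single γ, (rootSystem H).pairingIn_same]
    · norm_num
    · intro c hc hne
      exact hG.harishChandra_pairwise hγ (by simpa [hS] using hc) hne.symm
    · intro hn
      exact absurd (by simpa [hS] using hγ) hn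
  have hS1 : ∀ α ∈ Phi₁Pos b σ, ∑ a ∈ S, (rootSystem H).pairingIn ℤ α a = 2 := by
    intro α hα
    obtain ⟨γ, h1, γ', h2, h⟩ := (htube.mem_Phi₁Pos_iff α).mp hα
    have := h t htmem
    rw [hγ γ h1, hγ γ' h2, hval] at this
    norm_num at this
    exact_mod_cast this
  have hS0 : ∀ i, b.toWeightBasis.coord q ((rootSystem H).root i) = 0 →
      ∑ a ∈ S, (rootSystem H).pairingIn ℤ i a = 0 := by
    intro i hi
    obtain ⟨γ, h1, γ', h2, h⟩ := (htube.mem_Phi₀_iff i).mp ((hσ.mem_Phi₀_iff i).mpr hi)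
    have := h t htmem
    rw [hγ γ h1, hγ γ' h2, hval, sub_self, mul_zero] at this
    exact_mod_cast this
  have huniq (A : Set H.root) (hA : A ∈ OrtMax (rootSystem H) (Phi₁Pos b σ))
      (hanti : IsAntichain (DomLE (rootSystem H) (Phi₀Pos b σ)) A) :
      A = {α ∈ Phi₁Pos b σ |
        {x ∈ Phi₁Pos b σ | DomLE (rootSystem H) (Phi₀Pos b σ) x α}.ncard =
        {x ∈ Phi₁Pos b σ | DomLE (rootSystem H) (Phi₀Pos b σ) α x}.ncard} := by
    obtain ⟨T, rfl⟩ := (Set.toFinite A).exists_finset_coe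
    exact hG.eq_setOf_ncard_eq hA hanti
      (fun α hα ↦ (hG.sum_pairingIn_eq hS1 hS0 hA α).trans (hS1 α hα))
      (fun i hi ↦ (hG.sum_pairingIn_eq hS1 hS0 hA i).trans (hS0 i hi))
  obtain ⟨B₀, hB₀⟩ := exists_mem_ortMax (rootSystem H) (Phi₁Pos b σ)
  obtain ⟨A, hA, hanti, -⟩ := hG.exists_antichain_subset_upClosure _ B₀ hB₀ rfl
  refine ⟨A, ⟨hA, hanti⟩, fun A' hA' hanti' ↦ ?_, fun B hB ↦ ?_⟩
  · rw [huniq A hA hanti, huniq A' hA' hanti']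
  -- The antichain produced inside `B^{≥₀}` depends on `B` only in appearance: by uniqueness it is
  -- `A`.
  · obtain ⟨A', hA', hanti', hsub⟩ := hG.exists_antichain_subset_upClosure _ B hB rfl
    rw [huniq A' hA' hanti', ← huniq A hA hanti] at hsub
    exact ⟨hσ.turnstile_of_subset_upClosure (mem_ortMax_iff.mp hB).1 hsub, hsub⟩
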